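/- Let $Y_0,Y_1,Y_2,\dots$ be i.i.d. random elements of a metric space $(E,d)$ (equipped with a $\sigma$-algebra for which $d$ is jointly measurable), such that for all distinct $i,j,l$ almost surely $d(Y_i,Y_j)\neq d(Y_i,Y_l)$. Fix $k\ge 1$. For $L\le n$ put $\mathcal S(n,L)=\{n-L+1,\dots,n\}$, and for $i,j\in\mathcal S(n,L)$ let $A^{+}_{n_L,ij}$ be the indicator that $Y_j$ is one of the first $k$ nearest neighbours of $Y_i$ among the observations with indices in $\mathcal S(n,L)$ (an observation is not its own neighbour). Assume **Condition 1.** There is a non-random constant $1\le \mathbb C<\infty$ such that almost surely, for all $n\in\mathbb N$, $\sup_{1\le j\le n}\sum_{i=1}^n A^{+}_{n,ij}\le \mathbb C$, where $A^+_{n,ij}=A^+_{n_n,ij}$ refers to the observations $Y_1,\dots,Y_n$. For each $L$ let $n=n(L)\ge L$ and (for $L \ge 1$) $t=t(L)\in\mathcal S(n,L)$, where both segment lengths are of exact order $L$: $t-(n-L)=\Theta(L)$ and $n-t=\Theta(L)$ as $L\to\infty$. Let $\mathbf P_{n_L}$ be a uniformly distributed random permutation of $\mathcal S(n,L)$, independent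 of the sequence of observations (the joint law of these permutations for different $L$ is arbitrary). With $B_{1,ij}=\mathbf 1(\mathbf P_{n_L}(i)\le t,\ \mathbf P_{n_L}(j)\le t)$ and $B_{2,ij}=\mathbf 1(\mathbf P_{n_L}(i)>t,\ \mathbf P_{n_L}(j)>t)$ put \[ R_{a,L}(t,n)=\sum_{i,j\in\mathcal S(n,L)}(A^+_{n_L,ij}+A^+_{n_L,ji})B_{a,ij}\quad(a=1,2),\qquad R_{\mathrm{diff},L}=R_{1,L}-R_{2,L},\qquad R_{w,L}=(1-p)R_{1,L}+p\,R_{2,L},\] with $p=p(t,n)=\frac{t-(n-L)-1}{L-2}$. For $\bullet\in\{\mathrm{diff},w\}$ let \[ Z_{\bullet,L|y}(t,n)=\frac{R_{\bullet,L}-\mathbf E(R_{\bullet,L})}{\sqrt{\mathbf{Var}(R_{\bullet,L}\mid \mathbf y)}},\qquad Z_{\bullet,L}(t,n)=\frac{R_{\bullet,L}-\mathbf E(R_{\bullet,L})}{\sqrt{\mathbf{Var}(R_{\bullet,L})}}, \] where $\mathbf{Var}(\cdot\mid\mathbf y)$ is the conditional variance given the observations (and a quotient with zero denominator is read as $0$).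 Then: 1. $Z_{w,L|y}(t,n)-Z_{w,L}(t,n)\to 0$ almost surely as $L\to\infty$. 2. If the in-degrees do not degenerate asymptotically, that is, if $\liminf_{L\to\infty} q_{k,L}>k^2-k$, where \[ q_{k,L}=\frac1L\,\mathbf E\Big(\sum_{i,j,l\in\mathcal S(n,L),\ j\ne l}A^+_{n_L,ji}A^+_{n_L,li}\Big),\] then $Z_{\mathrm{diff},L|y}(t,n)-Z_{\mathrm{diff},L}(t,n)\to 0$ almost surely as $L\to\infty$. -/

import Mathlib

open MeasureTheory ProbabilityTheory Filter Topology Asymptotics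
open scoped ENNReal

/-- The index window `{n - L + 1, …, n}` of the `L` most recent observations at time `n`. -/
abbrev window (n L : ℕ) : Finset ℕ := Finset.Ioc (n - L) n

open Classical in
/-- The number of observations `y l`, `l ∈ S`, `l ≠ i`, strictly closer to `y i` than `y j` is. -/
noncomputable def closerCount {E : Type*} [MetricSpace E] (S : Finset ℕ) (y : ℕ → E)
    (i j : ℕ) : ℕ :=
  (S.filter fun l => l ≠ i ∧ dist (y i) (y l) < dist (y i) (y j)).card

open Classical in
/-- Indicator that `y j` is the `r`-th nearest neighbour of `y i` among the observations with
indices in `S`. -/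
noncomputable def nnInd {E : Type*} [MetricSpace E] (S : Finset ℕ) (y : ℕ → E)
    (r i j : ℕ) : ℝ :=
  if i ∈ S ∧ j ∈ S ∧ j ≠ i ∧ closerCount S y i j + 1 = r then 1 else 0

/-- `A⁺_{ij}`: the sum over `r = 1, …, k` of the indicators that `y j` is the `r`-th nearest
neighbour of `y i` among the observations with indices in `S`. -/
noncomputable def knnInd {E : Type*} [MetricSpace E] (S : Finset ℕ) (y : ℕ → E)
    (k i j : ℕ) : ℝ :=
  ∑ r ∈ Finset.Icc 1 k, nnInd S y r i j

/-- Bounded in-degrees: there is a nonrandom constant `C ≥ 1` such that, almost surely, for every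
`n`, all in-degrees of the `k`-nearest-neighbour graph on `Y 1, …, Y n` are at most `C`. -/
def BoundedInDegree {Ω E : Type*} [MeasurableSpace Ω] [MetricSpace E] (μ : Measure Ω)
    (Y : ℕ → Ω → E) (k : ℕ) : Prop :=
  ∃ C : ℝ, 1 ≤ C ∧ ∀ᵐ ω ∂μ, ∀ n : ℕ, ∀ j ∈ Finset.Icc 1 n,
    ∑ i ∈ Finset.Icc 1 n, knnInd (Finset.Icc 1 n) (fun m => Y m ω) k i j ≤ C

/-- Indicator that both indices lie in the first sample (indices at most `t`). -/
def bFst (t i j : ℕ) : ℝ := if i ≤ t ∧ j ≤ t then 1 else 0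

/-- Indicator that both indices lie in the second sample (indices larger than `t`). -/
def bSnd (t i j : ℕ) : ℝ := if t < i ∧ t < j then 1 else 0

/-- The within-sample-1 edge count after the permutation `σ` of the window indices. -/
noncomputable def edgeCount1 {E : Type*} [MetricSpace E] (k t n L : ℕ) (y : ℕ → E)
    (σ : Equiv.Perm (window n L)) : ℝ :=
  ∑ i : window n L, ∑ j : window n L,
    (knnInd (window n L) y k i j + knnInd (window n L) y k j i) * bFst t (σ i) (σ j)

/-- The within-sample-2 edge count after the permutation `σ` of the window indices. -/
noncomputable def edgeCount2 {E : Type*} [MetricSpace E] (k t n L : ℕ) (y : ℕ → E)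
    (σ : Equiv.Perm (window n L)) : ℝ :=
  ∑ i : window n L, ∑ j : window n L,
    (knnInd (window n L) y k i j + knnInd (window n L) y k j i) * bSnd t (σ i) (σ j)

/-- `R_diff = R₁ - R₂`. -/
noncomputable def edgeDiff {E : Type*} [MetricSpace E] (k t n L : ℕ) (y : ℕ → E)
    (σ : Equiv.Perm (window n L)) : ℝ :=
  edgeCount1 k t n L y σ - edgeCount2 k t n L y σ

/-- The weight `p(t,n) = (t - (n - L) - 1) / (L - 2)`, computed in `ℝ`. -/
noncomputable def weightP (t n L : ℕ) : ℝ := ((t : ℝ) - ((n : ℝ) - L) - 1) / ((L : ℝ) - 2)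

/-- `R_w = q R₁ + p R₂` with `q = 1 - p`. -/
noncomputable def edgeWeighted {E : Type*} [MetricSpace E] (k t n L : ℕ) (y : ℕ → E)
    (σ : Equiv.Perm (window n L)) : ℝ :=
  (1 - weightP t n L) * edgeCount1 k t n L y σ + weightP t n L * edgeCount2 k t n L y σ

/-- The random permutation `P` is uniformly distributed on the permutations of the window indices
and independent of the sequence of observations. -/
structure IsUniformPerm {Ω E : Type*} [MeasurableSpace Ω] [MeasurableSpace E] (μ : Measure Ω)
    (Y : ℕ → Ω → E) {n L : ℕ} (P : Ω → Equiv.Perm (window n L)) : Prop where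
  measurable : ∀ σ, MeasurableSet (P ⁻¹' {σ})
  uniform : ∀ σ, μ (P ⁻¹' {σ}) = (Fintype.card (Equiv.Perm (window n L)) : ℝ≥0∞)⁻¹
  indep : Indep (MeasurableSpace.comap P ⊤)
    (MeasurableSpace.comap (fun ω i => Y i ω) MeasurableSpace.pi) μ

/-- Unconditional standardization `(R - E R) / √(Var R)`. -/
noncomputable def standardized {Ω : Type*} [MeasurableSpace Ω] (μ : Measure Ω) (R : Ω → ℝ)
    (ω : Ω) : ℝ :=
  (R ω - ∫ ω', R ω' ∂μ) / √(variance R μ)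

/-- Conditional standardization `(R - E R) / √(Var(R | y))`: the variance is the conditional
variance of `R` given the observations. -/
noncomputable def condStandardized {Ω E : Type*} [MeasurableSpace Ω] [MeasurableSpace E]
    (μ : Measure Ω) (Y : ℕ → Ω → E) (R : Ω → ℝ) (ω : Ω) : ℝ :=
  (R ω - ∫ ω', R ω' ∂μ) /
    √(condVar (MeasurableSpace.comap (fun ω' i => Y i ω') MeasurableSpace.pi) R μ ω)

/-- `q_{k,L} = (1/L) E ∑_{i,j,l, j ≠ l} A⁺_{ji} A⁺_{li}`, over `i, j, l` in the window. -/
noncomputable def sharedNN {Ω E : Type*} [MeasurableSpace Ω] [MetricSpace E] (μ : Measure Ω)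
    (Y : ℕ → Ω → E) (k n L : ℕ) : ℝ :=
  (1 / (L : ℝ)) * ∫ ω, (∑ i ∈ window n L, ∑ j ∈ window n L, ∑ l ∈ (window n L).erase j,
    knnInd (window n L) (fun m => Y m ω) k j i * knnInd (window n L) (fun m => Y m ω) k l i) ∂μ

/-! Both standardizations have the same numerator `x = R - E R`, so with `V = Var(R | y)` and `v =
Var R` everything reduces to `x/√V - x/√v = x (v - V) / (√V √v (√V + √v))`. If `|x|` and `|V - v|`
are almost surely `O(√(L log L))` and `v ≥ c L`, the difference is `O(log L / √L)`
(`tendsto_div_sqrt_sub_div_sqrt`).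

Given the observations, each statistic is a quadratic form `∑ A⁺ i j * Φ (σ i) (σ j)` in a uniform
permutation. Without ties all out-degrees equal `k` once `k < L`. Hence the conditional mean is
deterministic, and the conditional variance depends on the graph only through the number of mutual
pairs and the sum of squared in-degrees, affinely and with bounded deterministic coefficients
(`PairMoments.favg_sum_sq`). As the conditional mean is constant, `v` is the expectation of `V`.

Numerator: composing the permutation with a transposition affects only edges at two vertices, a
bounded number by the degree bounds, so a martingale-type induction over permutations gives
sub-Gaussian tails (`favg_perm_indicator_le`). Variance: deleting one observation changes both graph
statistics by a bounded amount, so McDiarmid's inequality in a leave-one-out form applies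
(`measure_abs_sub_integral_ge_le`). Borel–Cantelli turns both into almost sure bounds; only the law
at each single `L` enters, so the coupling of the permutations for different `L` is irrelevant.

Lower bounds for `v`: the weight `p` makes all off-diagonal row sums of the weighted kernel equal,
so after centring the mixed moments are of lower order and `v` is at least of order `L`
(`le_weighted_variance`). The difference kernel is additive, mutual pairs cancel, and `v` is of the
order of the expected sum of squared in-degrees minus `k² L` (`le_diff_variance`); the condition on
`q_{k,L}` says that this is at least of order `L`. -/

/-- Hoeffding's lemma for a variable within distance `c` of a constant. -/
theorem integral_exp_mul_le_of_ae_abs_sub_le {X : Type*} [MeasurableSpace X] {ν : Measure X}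
    [IsProbabilityMeasure ν] {f : X → ℝ} (hf : AEMeasurable f ν) {a c : ℝ} (hc : 0 ≤ c)
    (h : ∀ᵐ x ∂ν, |f x - a| ≤ c) (s : ℝ) :
    ∫ x, Real.exp (s * f x) ∂ν ≤ Real.exp (s * ∫ x, f x ∂ν + s ^ 2 * c ^ 2 / 2) := by
  have hI : ∀ᵐ x ∂ν, f x ∈ Set.Icc (a - c) (a + c) := by
    filter_upwards [h] with x hx
    rw [abs_le] at hx
    constructor <;> linarith
  have key := (hasSubgaussianMGF_of_mem_Icc hf hI).mgf_le s
  rw [mgf] at key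
  have e1 : ∀ x, Real.exp (s * f x)
      = Real.exp (s * ∫ x, f x ∂ν) * Real.exp (s * (f x - ∫ x, f x ∂ν)) := fun x => by
    rw [← Real.exp_add]; congr 1; ring
  simp_rw [e1]
  rw [integral_const_mul, Real.exp_add]
  refine mul_le_mul_of_nonneg_left (key.trans (le_of_eq ?_)) (Real.exp_pos _).le
  congr 1
  have : a + c - (a - c) = 2 * c := by ring
  simp only [this, NNReal.coe_pow, NNReal.coe_div, coe_nnnorm, Real.norm_eq_abs,
    abs_of_nonneg (show 0 ≤ 2 * c by linarith), NNReal.coe_ofNat]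
  ring

/-! ### McDiarmid's inequality by resampling coordinates of an i.i.d. sequence -/

section Resampling

variable {E : Type*} [MeasurableSpace E] (ν : Measure E) [IsProbabilityMeasure ν]

theorem measurable_update_prod (i : ℕ) :
    Measurable fun p : (ℕ → E) × E => Function.update p.1 i p.2 := by
  refine measurable_pi_iff.2 fun j => ?_
  by_cases h : j = i
  · subst h; simpa using measurable_snd
  · simpa [h, Function.comp_def] using
      (measurable_pi_apply (X := fun _ : ℕ => E) j).comp (measurable_fst (β := E))

/-- Replacing one coordinate of an i.i.d. sequence by an independent copy preserves its law. -/
theorem measurePreserving_update (i : ℕ) :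
    MeasurePreserving (fun p : (ℕ → E) × E => Function.update p.1 i p.2)
      ((Measure.infinitePi fun _ : ℕ => ν).prod ν) (Measure.infinitePi fun _ : ℕ => ν) := by
  refine ⟨measurable_update_prod i, Measure.eq_infinitePi _ fun s t ht => ?_⟩
  rw [Measure.map_apply (measurable_update_prod i)
    (MeasurableSet.pi s.countable_toSet fun j _ => ht j)]
  have hset : (fun p : (ℕ → E) × E => Function.update p.1 i p.2) ⁻¹' (Set.pi s t)
      = (Set.pi (s.erase i : Finset ℕ) t) ×ˢ (if i ∈ s then t i else Set.univ) := by
    ext ⟨y, x⟩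
    simp only [Set.mem_preimage, Set.mem_pi, Set.mem_prod, Finset.coe_erase, Set.mem_sdiff,
      Finset.mem_coe, Set.mem_singleton_iff]
    constructor
    · intro h
      refine ⟨fun j hj => by simpa [hj.2] using h j hj.1, ?_⟩
      split_ifs with hi
      · simpa using h i hi
      · trivial
    · rintro ⟨h1, h2⟩ j hj
      by_cases hji : j = i
      · subst hji; simpa [hj] using h2
      · simpa [hji] using h1 j ⟨hj, hji⟩
  rw [hset, Measure.prod_prod, Measure.infinitePi_pi _ fun j _ => ht j]
  split_ifs with hi
  · rw [Finset.prod_erase_mul _ _ hi]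
  · rw [Finset.erase_eq_of_notMem hi, measure_univ, mul_one]

/-- Resampling preserves the law, so Fubini applies. This lets bounds known only almost surely be
used on the fibres over one coordinate. -/
theorem ae_ae_update {p : (ℕ → E) → Prop} (i : ℕ)
    (hp : ∀ᵐ y ∂(Measure.infinitePi fun _ : ℕ => ν), p y) :
    ∀ᵐ y ∂(Measure.infinitePi fun _ : ℕ => ν), ∀ᵐ x ∂ν, p (Function.update y i x) :=
  Measure.ae_ae_of_ae_prod ((measurePreserving_update ν i).quasiMeasurePreserving.ae hp)

theorem integrable_of_measurable_of_bound {X : Type*} [MeasurableSpace X] {m : Measure X}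
    [IsFiniteMeasure m] {f : X → ℝ} (hf : Measurable f) {B : ℝ} (hB : ∀ x, |f x| ≤ B) :
    Integrable f m :=
  Integrable.of_bound hf.aestronglyMeasurable B (ae_of_all _ hB)

theorem integral_integral_update {f : (ℕ → E) → ℝ} (hf : Measurable f) {B : ℝ}
    (hB : ∀ y, |f y| ≤ B) (i : ℕ) :
    ∫ y, ∫ x, f (Function.update y i x) ∂ν ∂(Measure.infinitePi fun _ : ℕ => ν)
      = ∫ y, f y ∂(Measure.infinitePi fun _ : ℕ => ν) := by
  have hmp := measurePreserving_update ν i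
  have h2 : Integrable (fun p : (ℕ → E) × E => f (Function.update p.1 i p.2))
      ((Measure.infinitePi fun _ : ℕ => ν).prod ν) :=
    integrable_of_measurable_of_bound (hf.comp hmp.measurable) fun _ => hB _
  rw [← integral_prod _ h2, ← hmp.map_eq,
    integral_map hmp.measurable.aemeasurable hf.aestronglyMeasurable, hmp.map_eq]

theorem measurable_integral_update {f : (ℕ → E) → ℝ} (hf : Measurable f) (i : ℕ) :
    Measurable fun y => ∫ x, f (Function.update y i x) ∂ν :=
  (StronglyMeasurable.integral_prod_right
    (f := fun (y : ℕ → E) (x : E) => f (Function.update y i x))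
    (hf.comp (measurable_update_prod i)).stronglyMeasurable).measurable

theorem abs_integral_le_of_bound {X : Type*} [MeasurableSpace X] {m : Measure X}
    [IsProbabilityMeasure m] {f : X → ℝ} {B : ℝ} (hB : ∀ᵐ x ∂m, |f x| ≤ B) :
    |∫ x, f x ∂m| ≤ B := by
  simpa using norm_integral_le_of_norm_le_const (μ := m) (f := f) (C := B) hB

/-- **McDiarmid's inequality**, moment generating function form: `f` depends on the coordinates
in `S`, and for each `i ∈ S` it is almost surely within distance `c` of a function that does not
depend on the `i`-th coordinate. -/
theorem integral_exp_le_of_bounded_differences {c : ℝ} (hc : 0 ≤ c) (s : ℝ) (S : Finset ℕ) :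
    ∀ f : (ℕ → E) → ℝ, Measurable f → (∃ B, ∀ y, |f y| ≤ B) →
      (∀ y y', (∀ i ∈ S, y i = y' i) → f y = f y') →
      (∀ i ∈ S, ∃ g : (ℕ → E) → ℝ, Measurable g ∧ (∃ B, ∀ y, |g y| ≤ B) ∧
        (∀ y x, g (Function.update y i x) = g y) ∧
        ∀ᵐ y ∂(Measure.infinitePi fun _ : ℕ => ν), |f y - g y| ≤ c) →
      ∫ y, Real.exp (s * f y) ∂(Measure.infinitePi fun _ : ℕ => ν)
        ≤ Real.exp (s * ∫ y, f y ∂(Measure.infinitePi fun _ : ℕ => ν)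
          + s ^ 2 * c ^ 2 * S.card / 2) := by
  induction S using Finset.induction_on with
  | empty =>
    intro f _ _ hdep _
    obtain ⟨y0⟩ : Nonempty (ℕ → E) :=
      (inferInstance : IsProbabilityMeasure (Measure.infinitePi fun _ : ℕ => ν)).neZero |>.1
        |> fun h => by
          by_contra hne
          rw [not_nonempty_iff] at hne
          exact h (Measure.eq_zero_of_isEmpty _)
    have : ∀ y, f y = f y0 := fun y => hdep y y0 (by simp)
    simp [this]
  | insert i S hi ih =>
    intro f hf ⟨B, hB⟩ hdep hdiff
    set Q := Measure.infinitePi fun _ : ℕ => ν with hQ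
    have hint : ∀ (f : (ℕ → E) → ℝ), Measurable f → (∀ B, (∀ y, |f y| ≤ B) → ∀ y,
        Integrable (fun x => f (Function.update y i x)) ν) := fun f hf B hB y =>
      integrable_of_measurable_of_bound
        (hf.comp ((measurable_update_prod i).comp (measurable_const.prodMk measurable_id)))
        fun _ => hB _
    -- Integrating out coordinate `i` keeps the mean and leaves a function of the coordinates in
    -- `S`; the induction hypothesis handles `G`, and Hoeffding's lemma handles `f` given the other
    -- coordinates.
    set G : (ℕ → E) → ℝ := fun y => ∫ x, f (Function.update y i x) ∂ν with hG
    have hGm : Measurable G := measurable_integral_update ν hf i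
    have hGB : ∀ y, |G y| ≤ B := fun y => abs_integral_le_of_bound (ae_of_all _ fun x => hB _)
    have hGint : ∫ y, G y ∂Q = ∫ y, f y ∂Q := integral_integral_update ν hf hB i
    have step := ih G hGm ⟨B, hGB⟩ ?_ ?_
    · have hexpB : ∀ y, |Real.exp (s * f y)| ≤ Real.exp (|s| * B) := fun y => by
        rw [abs_of_pos (Real.exp_pos _), Real.exp_le_exp]
        calc s * f y ≤ |s * f y| := le_abs_self _
          _ = |s| * |f y| := abs_mul _ _
          _ ≤ |s| * B := mul_le_mul_of_nonneg_left (hB y) (abs_nonneg _)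
      have hexpG : ∀ y, |Real.exp (s * G y + s ^ 2 * c ^ 2 / 2)|
          ≤ Real.exp (|s| * B + s ^ 2 * c ^ 2 / 2) := fun y => by
        rw [abs_of_pos (Real.exp_pos _), Real.exp_le_exp]
        refine add_le_add_left ?_ _
        calc s * G y ≤ |s * G y| := le_abs_self _
          _ = |s| * |G y| := abs_mul _ _
          _ ≤ |s| * B := mul_le_mul_of_nonneg_left (hGB y) (abs_nonneg _)
      obtain ⟨g, -, -, hgi, hfg⟩ := hdiff i (Finset.mem_insert_self _ _)
      have hexpm : Measurable fun y => Real.exp (s * f y) := (hf.const_mul s).exp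
      rw [← integral_integral_update ν hexpm hexpB i]
      calc ∫ y, ∫ x, Real.exp (s * f (Function.update y i x)) ∂ν ∂Q
          ≤ ∫ y, Real.exp (s * G y + s ^ 2 * c ^ 2 / 2) ∂Q := by
            refine integral_mono_ae
              (integrable_of_measurable_of_bound (measurable_integral_update ν hexpm i)
                fun y => abs_integral_le_of_bound (ae_of_all _ fun x => hexpB _))
              (integrable_of_measurable_of_bound
                (((hGm.const_mul s).add_const _).exp) hexpG) ?_
            filter_upwards [ae_ae_update ν i hfg] with y hy
            -- On the fibre the approximant `g` is constant, so it serves as the centre in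
            -- Hoeffding's lemma.
            refine integral_exp_mul_le_of_ae_abs_sub_le (a := g y)
              (hint f hf B hB y).aestronglyMeasurable.aemeasurable hc ?_ s
            filter_upwards [hy] with x hx
            rwa [hgi] at hx
        _ = Real.exp (s ^ 2 * c ^ 2 / 2) * ∫ y, Real.exp (s * G y) ∂Q := by
            rw [← integral_const_mul]
            congr 1; ext y
            rw [← Real.exp_add]; congr 1; ring
        _ ≤ Real.exp (s ^ 2 * c ^ 2 / 2)
            * Real.exp (s * ∫ y, G y ∂Q + s ^ 2 * c ^ 2 * S.card / 2) :=
            mul_le_mul_of_nonneg_left step (Real.exp_pos _).le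
        _ = _ := by
            rw [← Real.exp_add, hGint, Finset.card_insert_of_notMem hi]
            congr 1; push_cast; ring
    · intro y y' h
      refine integral_congr_ae (ae_of_all _ fun x => hdep _ _ fun j hj => ?_)
      by_cases hji : j = i
      · subst hji; simp
      · simpa [hji] using h j ((Finset.mem_insert.1 hj).resolve_left hji)
    · intro j hj
      obtain ⟨g, hgm, ⟨B', hB'⟩, hgj, hfg⟩ := hdiff j (Finset.mem_insert_of_mem hj)
      have hji : j ≠ i := fun h => hi (h ▸ hj)
      -- Averaging the approximant for coordinate `j` over coordinate `i` gives an approximant for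
      -- `G`, since updates at distinct coordinates commute.
      refine ⟨fun y => ∫ x, g (Function.update y i x) ∂ν, measurable_integral_update ν hgm i,
        ⟨B', fun y => abs_integral_le_of_bound (ae_of_all _ fun x => hB' _)⟩, fun y x => ?_, ?_⟩
      · refine integral_congr_ae (ae_of_all _ fun z => ?_)
        simp only
        rw [Function.update_comm hji, hgj]
      · filter_upwards [ae_ae_update ν i hfg] with y hy
        rw [hG, ← integral_sub (hint f hf B hB y) (hint g hgm B' hB' y)]
        exact abs_integral_le_of_bound hy

/-- **McDiarmid's inequality**. -/
theorem measure_abs_sub_integral_ge_le {c : ℝ} (hc : 0 < c) {S : Finset ℕ} (hS : S.Nonempty)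
    {f : (ℕ → E) → ℝ} (hf : Measurable f) (hB : ∃ B, ∀ y, |f y| ≤ B)
    (hdep : ∀ y y', (∀ i ∈ S, y i = y' i) → f y = f y')
    (hdiff : ∀ i ∈ S, ∃ g : (ℕ → E) → ℝ, Measurable g ∧ (∃ B, ∀ y, |g y| ≤ B) ∧
        (∀ y x, g (Function.update y i x) = g y) ∧
        ∀ᵐ y ∂(Measure.infinitePi fun _ : ℕ => ν), |f y - g y| ≤ c) {r : ℝ} (hr : 0 ≤ r) :
    (Measure.infinitePi fun _ : ℕ => ν).real
        {y | r ≤ |f y - ∫ y, f y ∂(Measure.infinitePi fun _ : ℕ => ν)|}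
      ≤ 2 * Real.exp (-r ^ 2 / (2 * (c ^ 2 * S.card))) := by
  set Q := Measure.infinitePi fun _ : ℕ => ν
  obtain ⟨B, hB'⟩ := hB
  have hsub : HasSubgaussianMGF (fun y => f y - ∫ y, f y ∂Q)
      (Real.toNNReal (c ^ 2 * S.card)) Q := by
    refine ⟨fun s => ?_, fun s => ?_⟩
    · refine integrable_of_measurable_of_bound (B := Real.exp (|s| * (B + |∫ y, f y ∂Q|)))
        (((hf.sub_const _).const_mul s).exp) fun y => ?_
      rw [abs_of_pos (Real.exp_pos _), Real.exp_le_exp]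
      calc s * (f y - ∫ y, f y ∂Q) ≤ |s * (f y - ∫ y, f y ∂Q)| := le_abs_self _
        _ = |s| * |f y - ∫ y, f y ∂Q| := abs_mul _ _
        _ ≤ |s| * (B + |∫ y, f y ∂Q|) :=
          mul_le_mul_of_nonneg_left
            ((abs_sub _ _).trans (add_le_add_left (hB' y) _)) (abs_nonneg _)
    · rw [Real.coe_toNNReal _ (by positivity), mgf]
      have e1 : ∀ y, Real.exp (s * (f y - ∫ y, f y ∂Q))
          = Real.exp (-(s * ∫ y, f y ∂Q)) * Real.exp (s * f y) := fun y => by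
        rw [← Real.exp_add]; congr 1; ring
      simp_rw [e1]
      rw [integral_const_mul]
      refine (mul_le_mul_of_nonneg_left (integral_exp_le_of_bounded_differences ν hc.le s S f hf
        ⟨B, hB'⟩ hdep hdiff) (Real.exp_pos _).le).trans (le_of_eq ?_)
      rw [← Real.exp_add]; congr 1; ring
  have h1 := hsub.measure_ge_le hr
  have h2 := hsub.neg.measure_ge_le hr
  rw [Real.coe_toNNReal _ (by positivity)] at h1 h2
  have hss : {y | r ≤ |f y - ∫ y, f y ∂Q|}
      ⊆ {y | r ≤ f y - ∫ y, f y ∂Q} ∪ {y | r ≤ (-fun y => f y - ∫ y, f y ∂Q) y} := fun y hy => by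
    rcases le_abs.1 (Set.mem_ofPred_eq ▸ hy) with h | h
    · exact Or.inl h
    · exact Or.inr h
  calc Q.real _ ≤ _ := measureReal_mono hss
    _ ≤ _ := measureReal_union_le _ _
    _ ≤ _ := by linarith

end Resampling

/-! ### Averages over finite types -/

/-- The average of a function on a finite type. -/
noncomputable def favg {β : Type*} [Fintype β] (f : β → ℝ) : ℝ :=
  (Fintype.card β : ℝ)⁻¹ * ∑ b, f b

section FAvg

variable {β γ : Type*} [Fintype β] [Fintype γ]

theorem favg_mono {f g : β → ℝ} (h : ∀ b, f b ≤ g b) : favg f ≤ favg g :=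
  mul_le_mul_of_nonneg_left (Finset.sum_le_sum fun b _ => h b) (by positivity)

theorem favg_const [Nonempty β] (a : ℝ) : favg (fun _ : β => a) = a := by
  have : (Fintype.card β : ℝ) ≠ 0 := by exact_mod_cast Fintype.card_ne_zero
  simp [favg, this]

theorem favg_add (f g : β → ℝ) : favg (fun b => f b + g b) = favg f + favg g := by
  simp [favg, Finset.sum_add_distrib, mul_add]

theorem favg_sub (f g : β → ℝ) : favg (fun b => f b - g b) = favg f - favg g := by
  simp [favg, Finset.sum_sub_distrib, mul_sub]

theorem favg_const_mul (a : ℝ) (f : β → ℝ) : favg (fun b => a * f b) = a * favg f := by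
  simp only [favg, ← Finset.mul_sum]; ring

theorem favg_mul_const (a : ℝ) (f : β → ℝ) : favg (fun b => f b * a) = favg f * a := by
  simp only [favg, ← Finset.sum_mul]; ring

theorem favg_sum {ι : Type*} (s : Finset ι) (f : ι → β → ℝ) :
    favg (fun b => ∑ i ∈ s, f i b) = ∑ i ∈ s, favg (f i) := by
  simp only [favg, ← Finset.mul_sum]; rw [Finset.sum_comm]

theorem favg_nonneg {f : β → ℝ} (h : ∀ b, 0 ≤ f b) : 0 ≤ favg f :=
  mul_nonneg (by positivity) (Finset.sum_nonneg fun b _ => h b)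

theorem abs_favg_le [Nonempty β] {f : β → ℝ} {B : ℝ} (h : ∀ b, |f b| ≤ B) : |favg f| ≤ B := by
  rw [abs_le]
  constructor
  · rw [← favg_const (β := β) (-B)]; exact favg_mono fun b => (abs_le.1 (h b)).1
  · rw [← favg_const (β := β) B]; exact favg_mono fun b => (abs_le.1 (h b)).2

theorem favg_comp_equiv (e : γ ≃ β) (f : β → ℝ) : favg (fun c => f (e c)) = favg f := by
  simp only [favg, Fintype.card_congr e, Equiv.sum_comp e f]

theorem favg_prod (f : β × γ → ℝ) : favg f = favg fun b => favg fun c => f (b, c) := by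
  simp only [favg, Fintype.card_prod, Fintype.sum_prod_type, ← Finset.mul_sum]
  push_cast
  rw [mul_inv, mul_assoc]

/-- Hoeffding's lemma for a function on a finite type. -/
theorem favg_exp_mul_le [Nonempty β] {f : β → ℝ} {a c : ℝ} (hc : 0 ≤ c)
    (h : ∀ b, |f b - a| ≤ c) (s : ℝ) :
    favg (fun b => Real.exp (s * f b)) ≤ Real.exp (s * favg f + s ^ 2 * c ^ 2 / 2) := by
  let _ : MeasurableSpace β := ⊤
  have : MeasurableSingletonClass β := ⟨fun _ => trivial⟩
  have e : ∀ g : β → ℝ, ∫ b, g b ∂(PMF.uniformOfFintype β).toMeasure = favg g := fun g => by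
    rw [PMF.integral_eq_sum, favg, Finset.mul_sum]
    simp
  have := integral_exp_mul_le_of_ae_abs_sub_le (ν := (PMF.uniformOfFintype β).toMeasure)
    (f := f) (measurable_from_top.aemeasurable) hc (ae_of_all _ h) s
  rwa [e, e] at this

end FAvg

/-! ### Concentration for uniform permutations -/

section PermConcentration

open Equiv

/-- Exponential concentration of functions of a uniform permutation that change by at most `c`
under transpositions. -/
theorem favg_perm_exp_le (α : Type*) [Fintype α] [DecidableEq α] {c : ℝ} (hc : 0 ≤ c) (s : ℝ) :
    ∀ f : Perm α → ℝ, (∀ a b σ, |f (swap a b * σ) - f σ| ≤ c) →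
      favg (fun σ => Real.exp (s * f σ))
        ≤ Real.exp (s * favg f + s ^ 2 * c ^ 2 * Fintype.card α / 2) := by
  -- The decidability instance has to be part of the motive, because the induction changes the type.
  suffices H : ∀ [DecidableEq α], ∀ f : Perm α → ℝ, (∀ a b σ, |f (swap a b * σ) - f σ| ≤ c) →
      favg (fun σ => Real.exp (s * f σ))
        ≤ Real.exp (s * favg f + s ^ 2 * c ^ 2 * Fintype.card α / 2) from H
  refine Fintype.induction_empty_option (P := fun α _ => ∀ [DecidableEq α], ∀ f : Perm α → ℝ,
    (∀ a b σ, |f (swap a b * σ) - f σ| ≤ c) →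
      favg (fun σ => Real.exp (s * f σ))
        ≤ Real.exp (s * favg f + s ^ 2 * c ^ 2 * Fintype.card α / 2)) ?_ ?_ ?_ α
  · intro α β _ e ih _ f hf
    classical
    let _ : Fintype α := Fintype.ofEquiv β e.symm
    have key := ih (fun σ => f (e.permCongr σ)) fun a b σ => by
      have : e.permCongr (swap a b * σ) = swap (e a) (e b) * e.permCongr σ := by
        ext x
        simp [Equiv.permCongr_apply, e.injective.swap_apply]
      simp only [this]
      exact hf _ _ _
    have h1 : favg (fun σ : Perm α => Real.exp (s * f (e.permCongr σ)))
      = favg fun σ => Real.exp (s * f σ) :=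
      favg_comp_equiv e.permCongr fun σ => Real.exp (s * f σ)
    have h2 : favg (fun σ : Perm α => f (e.permCongr σ)) = favg f := favg_comp_equiv e.permCongr f
    have h3 : Fintype.card α = Fintype.card β := Fintype.card_congr e
    convert key using 1
    · rw [← h1]
    · rw [← h2, ← h3]
  · intro _ f _
    have h : ∀ σ, f σ = f 1 := fun σ => by rw [Subsingleton.elim σ 1]
    have h' : favg f = f 1 := by
      rw [show f = fun _ => f 1 from funext h, favg_const]
    rw [h', show (fun σ => Real.exp (s * f σ)) = fun _ => Real.exp (s * f 1) from
      funext fun σ => by rw [h σ], favg_const]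
    simp
  · intro α _ ih inst f hf
    let dα : DecidableEq α := Classical.decEq α
    have hi : inst = @Option.instDecidableEq α dα := Subsingleton.elim _ _
    subst hi
    -- A permutation of `Option α` is the image `i` of `none` together with a permutation of `α`.
    -- Revealing `i` is one martingale step; the rest is the induction hypothesis.
    set D := (Perm.decomposeOption (α := α)).symm with hD
    have hDi : ∀ i τ, D (i, τ) = swap none i * D (none, τ) := fun i τ => by
      simp only [hD, Perm.decomposeOption_symm_apply, swap_self]
      rw [← Perm.one_def, one_mul]
    set g : Option α → ℝ := fun i => favg fun τ => f (D (i, τ)) with hg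
    have hcard : (Fintype.card (Option α) : ℝ) = Fintype.card α + 1 := by
      rw [Fintype.card_option]; push_cast; ring
    have hfg : favg f = favg g := by
      rw [← favg_comp_equiv D f, favg_prod]
    rw [← favg_comp_equiv D (fun σ => Real.exp (s * f σ)), favg_prod, hfg]
    calc favg (fun i => favg fun τ => Real.exp (s * f (D (i, τ))))
        ≤ favg (fun i => Real.exp (s * g i) * Real.exp (s ^ 2 * c ^ 2 * Fintype.card α / 2)) := by
          refine favg_mono fun i => ?_
          rw [← Real.exp_add]
          convert ih (fun τ => f (D (i, τ))) fun a b τ => ?_ using 1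
          -- A transposition inside the fibre is left multiplication by its conjugate under `swap
          -- none i`, again a transposition, so the fibre function inherits the constant `c`.
          have : D (i, swap a b * τ)
              = swap (swap none i (some a)) (swap none i (some b)) * D (i, τ) := by
            simp only [hD, Perm.decomposeOption_symm_apply]
            rw [← mul_assoc, ← Equiv.mul_swap_eq_swap_mul, mul_assoc]
            congr 1
            ext x
            cases x with
            | none => simp [swap_apply_def]
            | some x =>
              simp only [optionCongr_apply, Option.map_some, Perm.coe_mul, Function.comp_apply,
                swap_apply_def, Option.some.injEq]
              split_ifs <;> simp
          simp only [this]
          exact hf _ _ _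
      _ = favg (fun i => Real.exp (s * g i)) * Real.exp (s ^ 2 * c ^ 2 * Fintype.card α / 2) :=
          favg_mul_const _ _
      _ ≤ Real.exp (s * favg g + s ^ 2 * c ^ 2 / 2)
          * Real.exp (s ^ 2 * c ^ 2 * Fintype.card α / 2) := by
          refine mul_le_mul_of_nonneg_right
            -- The fibres over `i` and `none` differ by one left transposition, so `g i` is within
            -- `c` of `g none`.
            (favg_exp_mul_le (a := g none) hc (fun i => ?_) s) (Real.exp_pos _).le
          simp only [hg]
          rw [← favg_sub]
          refine abs_favg_le fun τ => ?_
          rw [hDi]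
          exact hf _ _ _
      _ = _ := by
          rw [← Real.exp_add, hcard]; congr 1; ring

/-- Tail bound for functions of a uniform permutation that change by at most `c` under
transpositions of the arguments. -/
theorem favg_perm_indicator_le (α : Type*) [Fintype α] [Nonempty α] [DecidableEq α] {c : ℝ}
    (hc : 0 < c) (f : Perm α → ℝ) (hf : ∀ a b σ, |f (σ * swap a b) - f σ| ≤ c) {r : ℝ}
    (hr : 0 ≤ r) :
    favg (fun σ => if r ≤ |f σ - favg f| then (1 : ℝ) else 0)
      ≤ 2 * Real.exp (-r ^ 2 / (2 * (c ^ 2 * Fintype.card α))) := by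
  have hl : ∀ a b σ, |f (swap a b * σ) - f σ| ≤ c := fun a b σ => by
    have : swap a b * σ = σ * swap (σ⁻¹ a) (σ⁻¹ b) := by
      rw [Equiv.mul_swap_eq_swap_mul]; simp
    rw [this]; exact hf _ _ _
  have hN : (0 : ℝ) < Fintype.card α := by exact_mod_cast Fintype.card_pos
  set V := c ^ 2 * (Fintype.card α : ℝ) with hV
  have hVpos : 0 < V := by positivity
  have hexp : ∀ s, favg (fun σ => Real.exp (s * (f σ - favg f))) ≤ Real.exp (s ^ 2 * V / 2) := by
    intro s
    have h := favg_perm_exp_le α hc.le s f hl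
    have e1 : ∀ σ, Real.exp (s * (f σ - favg f))
        = Real.exp (-(s * favg f)) * Real.exp (s * f σ) := fun σ => by
      rw [← Real.exp_add]; congr 1; ring
    simp_rw [e1]
    rw [favg_const_mul]
    refine (mul_le_mul_of_nonneg_left h (Real.exp_pos _).le).trans (le_of_eq ?_)
    rw [← Real.exp_add]; congr 1; rw [hV]; ring
  -- This is the minimizer of the Chernoff exponent `-s r + s² V / 2`.
  set s := r / V with hs
  have hs0 : 0 ≤ s := by positivity
  calc favg (fun σ => if r ≤ |f σ - favg f| then (1 : ℝ) else 0)
      ≤ favg (fun σ => Real.exp (-(s * r)) *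
          (Real.exp (s * (f σ - favg f)) + Real.exp (-s * (f σ - favg f)))) := by
        refine favg_mono fun σ => ?_
        split_ifs with h
        · rw [mul_add, ← Real.exp_add, ← Real.exp_add]
          rcases le_abs.1 h with h | h
          · have : 1 ≤ Real.exp (-(s * r) + s * (f σ - favg f)) := by
              rw [Real.one_le_exp_iff]; nlinarith [mul_le_mul_of_nonneg_left h hs0]
            linarith [Real.exp_pos (-(s * r) + -s * (f σ - favg f))]
          · have : 1 ≤ Real.exp (-(s * r) + -s * (f σ - favg f)) := by
              rw [Real.one_le_exp_iff]; nlinarith [mul_le_mul_of_nonneg_left h hs0]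
            linarith [Real.exp_pos (-(s * r) + s * (f σ - favg f))]
        · positivity
    _ = Real.exp (-(s * r)) * (favg (fun σ => Real.exp (s * (f σ - favg f)))
          + favg (fun σ => Real.exp (-s * (f σ - favg f)))) := by
        rw [favg_const_mul, favg_add]
    _ ≤ Real.exp (-(s * r)) * (Real.exp (s ^ 2 * V / 2) + Real.exp ((-s) ^ 2 * V / 2)) :=
        mul_le_mul_of_nonneg_left (add_le_add (hexp s) (hexp (-s))) (Real.exp_pos _).le
    _ = _ := by
        rw [neg_sq, ← two_mul, mul_left_comm, ← Real.exp_add]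
        congr 2
        rw [hs]; field_simp; ring

end PermConcentration

/-! ### Moments of quadratic forms in a uniform permutation -/

section PermMoments

open Equiv

variable {α : Type*} [Fintype α] [DecidableEq α]

theorem favg_perm_mul_right (π : Perm α) (f : Perm α → ℝ) :
    favg (fun σ => f (σ * π)) = favg f :=
  favg_comp_equiv (Equiv.mulRight π) f

/-- The average of `h (σ i) (σ j) * h' (σ l) (σ q)` is invariant under relabelling the
arguments. -/
theorem favg_perm_relabel (π : Perm α) (h h' : α → α → ℝ) (i j l q : α) :
    favg (fun σ : Perm α => h (σ (π i)) (σ (π j)) * h' (σ (π l)) (σ (π q)))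
      = favg fun σ : Perm α => h (σ i) (σ j) * h' (σ l) (σ q) :=
  favg_perm_mul_right π fun σ => h (σ i) (σ j) * h' (σ l) (σ q)

/-- By symmetry the mean does not depend on `i`, and the sum over all `i` is the constant `∑ a, u
a`. -/
theorem favg_perm_apply (u : α → ℝ) (i : α) :
    favg (fun σ : Perm α => u (σ i)) = (Fintype.card α : ℝ)⁻¹ * ∑ a, u a := by
  have hinv : ∀ j, favg (fun σ : Perm α => u (σ j)) = favg fun σ : Perm α => u (σ i) := fun j => by
    rw [← favg_perm_mul_right (swap i j)]
    simp
  have hN : (Fintype.card α : ℝ) ≠ 0 := by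
    have : Nonempty α := ⟨i⟩
    exact_mod_cast Fintype.card_ne_zero
  have : ∑ j, favg (fun σ : Perm α => u (σ j)) = ∑ a, u a := by
    rw [← favg_sum]
    simp_rw [Equiv.sum_comp]
    exact favg_const _
  simp_rw [hinv] at this
  rw [Finset.sum_const, nsmul_eq_mul, Finset.card_univ] at this
  field_simp
  linarith

/-- Sum over a finite type of a function constant off a set of exceptional points. -/
theorem sum_eq_of_const_off (s : Finset α) (f : α → ℝ) (b : ℝ) (hb : ∀ a ∉ s, f a = b) :
    ∑ a, f a = ∑ a ∈ s, f a + ((Fintype.card α : ℝ) - s.card) * b := by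
  rw [← Finset.sum_add_sum_compl s f, Finset.sum_congr rfl fun a ha => hb a (Finset.mem_compl.1 ha),
    Finset.sum_const, nsmul_eq_mul, Finset.card_compl, Nat.cast_sub (Finset.card_le_univ s)]

/-- Multiply `u (σ i)` by `∑ l, u (σ l) = 0`: the diagonal term must cancel `card α - 1` equal
covariances. -/
theorem favg_perm_apply_mul_apply {u : α → ℝ} (hu : ∑ a, u a = 0) {i j : α} (hij : i ≠ j) :
    favg (fun σ : Perm α => u (σ i) * u (σ j))
      = -((Fintype.card α : ℝ)⁻¹ * ∑ a, u a ^ 2) / (Fintype.card α - 1) := by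
  have hinv : ∀ l, l ∉ ({i} : Finset α) → favg (fun σ : Perm α => u (σ i) * u (σ l))
      = favg fun σ : Perm α => u (σ i) * u (σ j) := fun l hl => by
    rw [Finset.mem_singleton] at hl
    rw [← favg_perm_mul_right (swap j l)]
    simp [swap_apply_of_ne_of_ne hij (Ne.symm hl)]
  have h0 : ∑ l, favg (fun σ : Perm α => u (σ i) * u (σ l)) = 0 := by
    rw [← favg_sum]
    simp_rw [← Finset.mul_sum, Equiv.sum_comp, hu, mul_zero]
    simp [favg]
  rw [sum_eq_of_const_off {i} _ _ hinv, Finset.sum_singleton, Finset.card_singleton] at h0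
  have h1 : favg (fun σ : Perm α => u (σ i) * u (σ i))
      = (Fintype.card α : ℝ)⁻¹ * ∑ a, u a ^ 2 := by
    rw [← favg_perm_apply (fun a => u a ^ 2) i]
    simp_rw [sq]
  have hN : (1 : ℝ) < Fintype.card α := by
    have := Fintype.one_lt_card_iff.2 ⟨i, j, hij⟩
    exact_mod_cast this
  rw [h1] at h0
  rw [eq_div_iff (by linarith)]
  push_cast at h0
  linarith

/-- The products `h (σ i) (σ j) * h (σ l) (σ q)` have averages depending only on whether the two
pairs coincide, share one point, or are disjoint. -/
structure PairMoments (h : α → α → ℝ) (c₀ c₁ c₂ : ℝ) : Prop where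
  symm : ∀ a b, h a b = h b a
  mean : ∀ i j, i ≠ j → favg (fun σ : Perm α => h (σ i) (σ j)) = 0
  same : ∀ i j, i ≠ j → favg (fun σ : Perm α => h (σ i) (σ j) * h (σ i) (σ j)) = c₂
  share : ∀ i j l, i ≠ j → i ≠ l → j ≠ l →
    favg (fun σ : Perm α => h (σ i) (σ j) * h (σ i) (σ l)) = c₁
  disj : ∀ i j l q, i ≠ j → i ≠ l → i ≠ q → j ≠ l → j ≠ q → l ≠ q →
    favg (fun σ : Perm α => h (σ i) (σ j) * h (σ l) (σ q)) = c₀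

/-- The number of shared points is 0, 1 or 2. The linear part interpolates the first two cases and
the product term corrects the third, since `c₀ + 2 (c₁ - c₀) + (c₂ - 2 c₁ + c₀) = c₂`. Writing this
with indicators makes the fourfold sum factor. -/
theorem PairMoments.favg_eq {h : α → α → ℝ} {c₀ c₁ c₂ : ℝ} (H : PairMoments h c₀ c₁ c₂)
    {i j l q : α} (hij : i ≠ j) (hlq : l ≠ q) :
    favg (fun σ : Perm α => h (σ i) (σ j) * h (σ l) (σ q))
      = c₀ + (c₁ - c₀) * ((if i = l then 1 else 0) + (if i = q then 1 else 0)
          + (if j = l then 1 else 0) + (if j = q then 1 else 0))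
        + (c₂ - 2 * c₁ + c₀) * ((if i = l then 1 else 0) * (if j = q then 1 else 0)
          + (if i = q then 1 else 0) * (if j = l then 1 else 0)) := by
  by_cases h1 : i = l
  · subst h1
    have h2 : j ≠ i := hij.symm
    by_cases h3 : j = q
    · subst h3
      simp only [H.same _ _ hij, hij, h2, if_true, if_false]; ring
    · simp only [H.share _ _ _ hij hlq h3, h2, hlq, h3, if_true, if_false]; ring
  by_cases h2 : i = q
  · subst h2
    by_cases h3 : j = l
    · subst h3
      have : (fun σ : Perm α => h (σ i) (σ j) * h (σ j) (σ i))
          = fun σ : Perm α => h (σ i) (σ j) * h (σ i) (σ j) := by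
        funext σ; rw [H.symm (σ j)]
      rw [this, H.same i j hij]
      simp only [h1, hlq, if_true, if_false]; ring
    · have : (fun σ : Perm α => h (σ i) (σ j) * h (σ l) (σ i))
          = fun σ : Perm α => h (σ i) (σ j) * h (σ i) (σ l) := by
        funext σ; rw [H.symm (σ l)]
      rw [this, H.share _ _ _ hij h1 h3]
      simp only [h1, h3, hij.symm, if_true, if_false]; ring
  by_cases h3 : j = l
  · subst h3
    have : (fun σ : Perm α => h (σ i) (σ j) * h (σ j) (σ q))
        = fun σ : Perm α => h (σ j) (σ i) * h (σ j) (σ q) := by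
      funext σ; rw [H.symm (σ i)]
    rw [this, H.share _ _ _ hij.symm hlq h2]
    simp only [h1, h2, hlq, if_true, if_false]; ring
  by_cases h4 : j = q
  · subst h4
    have : (fun σ : Perm α => h (σ i) (σ j) * h (σ l) (σ j))
        = fun σ : Perm α => h (σ j) (σ i) * h (σ j) (σ l) := by
      funext σ; rw [H.symm (σ i), H.symm (σ l)]
    rw [this, H.share _ _ _ hij.symm h3 h1]
    simp only [h1, h2, h3, if_true, if_false]; ring
  rw [H.disj _ _ _ _ hij h1 h2 h3 h4 hlq]
  simp only [h1, h2, h3, h4, if_false]; ring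

/-- Second moment of `∑ A i j * h (σ i) (σ j)` for a directed graph without loops whose
out-degrees are all equal to `k`. -/
theorem PairMoments.favg_sum_sq {h : α → α → ℝ} {c₀ c₁ c₂ : ℝ} (H : PairMoments h c₀ c₁ c₂)
    {A : α → α → ℝ} {k : ℝ} (hdiag : ∀ i, A i i = 0) (hrow : ∀ i, ∑ j, A i j = k)
    (hidem : ∀ i j, A i j * A i j = A i j) :
    favg (fun σ : Perm α => (∑ i, ∑ j, A i j * h (σ i) (σ j)) ^ 2)
      = (c₂ - 2 * c₁ + c₀) * (k * Fintype.card α + ∑ i, ∑ j, A i j * A j i)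
        + (c₁ - c₀) * (3 * k ^ 2 * Fintype.card α + ∑ j, (∑ i, A i j) ^ 2)
        + c₀ * (k ^ 2 * Fintype.card α ^ 2) := by
  have htot : ∑ i, ∑ j, A i j = k * Fintype.card α := by
    simp [hrow, mul_comm]
  have hsq : ∀ σ : Perm α, (∑ i, ∑ j, A i j * h (σ i) (σ j)) ^ 2
      = ∑ i, ∑ j, ∑ l, ∑ q, A i j * A l q * (h (σ i) (σ j) * h (σ l) (σ q)) := fun σ => by
    rw [sq, Finset.sum_mul]
    refine Finset.sum_congr rfl fun i _ => ?_
    rw [Finset.sum_mul]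
    refine Finset.sum_congr rfl fun j _ => ?_
    rw [Finset.mul_sum]
    refine Finset.sum_congr rfl fun l _ => ?_
    rw [Finset.mul_sum]
    refine Finset.sum_congr rfl fun q _ => ?_
    ring
  have hterm : ∀ i j l q, favg (fun σ : Perm α =>
        A i j * A l q * (h (σ i) (σ j) * h (σ l) (σ q)))
      = c₀ * (A i j * A l q)
        + (c₁ - c₀) * ((if i = l then A i j * A l q else 0) + (if i = q then A i j * A l q else 0)
          + (if j = l then A i j * A l q else 0) + (if j = q then A i j * A l q else 0))
        + (c₂ - 2 * c₁ + c₀) * ((if i = l then (if j = q then A i j * A l q else 0) else 0)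
          + (if i = q then (if j = l then A i j * A l q else 0) else 0)) := by
    intro i j l q
    rw [favg_const_mul]
    by_cases hij : i = j
    · subst hij; simp [hdiag]
    by_cases hlq : l = q
    · subst hlq; simp [hdiag]
    rw [H.favg_eq hij hlq]
    split_ifs <;> ring
  simp_rw [hsq, favg_sum, hterm, Finset.sum_add_distrib, ← Finset.mul_sum, Finset.sum_add_distrib]
  -- For two edges `i → j` and `l → q`, a common tail and both head-to-tail matches (`e1`, `e2`,
  -- `e3`) see only out-degrees. A common head (`e4`) produces the squared in-degrees; equal and
  -- reversed edges (`e5`, `e6`) produce the edge count and the mutual pairs.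
  have e0 : ∑ i, ∑ j, A i j * ∑ l, ∑ q, A l q = (k * Fintype.card α) ^ 2 := by
    simp_rw [htot, ← Finset.sum_mul, htot, sq]
  have e1 : ∑ i, ∑ j, ∑ l, ∑ q, (if i = l then A i j * A l q else 0)
      = k ^ 2 * Fintype.card α := by
    have : ∀ i j, ∑ l, ∑ q, (if i = l then A i j * A l q else 0) = A i j * k := fun i j => by
      rw [Finset.sum_comm]; simp [← Finset.mul_sum, hrow]
    simp_rw [this, ← Finset.sum_mul, htot]; ring
  have e2 : ∑ i, ∑ j, ∑ l, ∑ q, (if i = q then A i j * A l q else 0)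
      = k ^ 2 * Fintype.card α := by
    have : ∀ i j, ∑ l, ∑ q, (if i = q then A i j * A l q else 0)
        = A i j * ∑ l, A l i := fun i j => by
      simp [← Finset.mul_sum]
    simp_rw [this, ← Finset.sum_mul, hrow]
    rw [← Finset.mul_sum, Finset.sum_comm, htot]; ring
  have e3 : ∑ i, ∑ j, ∑ l, ∑ q, (if j = l then A i j * A l q else 0)
      = k ^ 2 * Fintype.card α := by
    have : ∀ i j, ∑ l, ∑ q, (if j = l then A i j * A l q else 0) = A i j * k := fun i j => by
      rw [Finset.sum_comm]; simp [← Finset.mul_sum, hrow]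
    simp_rw [this, ← Finset.sum_mul, htot]; ring
  have e4 : ∑ i, ∑ j, ∑ l, ∑ q, (if j = q then A i j * A l q else 0)
      = ∑ j, (∑ i, A i j) ^ 2 := by
    have : ∀ i j, ∑ l, ∑ q, (if j = q then A i j * A l q else 0)
        = A i j * ∑ l, A l j := fun i j => by
      simp [← Finset.mul_sum]
    simp_rw [this]
    rw [Finset.sum_comm]
    simp_rw [← Finset.sum_mul, sq]
  have e5 : ∑ i, ∑ j, ∑ l, ∑ q, (if i = l then (if j = q then A i j * A l q else 0) else 0)
      = k * Fintype.card α := by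
    have : ∀ i j, ∑ l, ∑ q, (if i = l then (if j = q then A i j * A l q else 0) else 0)
        = A i j := fun i j => by
      rw [Finset.sum_comm]; simp [hidem]
    simp_rw [this, htot]
  have e6 : ∑ i, ∑ j, ∑ l, ∑ q, (if i = q then (if j = l then A i j * A l q else 0) else 0)
      = ∑ i, ∑ j, A i j * A j i := by
    simp
  rw [e0, e1, e2, e3, e4, e5, e6]
  ring

theorem PairMoments.favg_sum_eq_zero {h : α → α → ℝ} {c₀ c₁ c₂ : ℝ} (H : PairMoments h c₀ c₁ c₂)
    {A : α → α → ℝ} (hdiag : ∀ i, A i i = 0) :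
    favg (fun σ : Perm α => ∑ i, ∑ j, A i j * h (σ i) (σ j)) = 0 := by
  simp_rw [favg_sum, favg_const_mul]
  refine Finset.sum_eq_zero fun i _ => Finset.sum_eq_zero fun j _ => ?_
  by_cases hij : i = j
  · subst hij; rw [hdiag, zero_mul]
  · rw [H.mean i j hij, mul_zero]

/-- Four distinct points are needed to realize all three constants as averages. -/
theorem PairMoments.abs_le {h : α → α → ℝ} {c₀ c₁ c₂ : ℝ} (H : PairMoments h c₀ c₁ c₂)
    (hcard : 4 ≤ Fintype.card α) {B : ℝ} (hB : ∀ a b, |h a b| ≤ B) :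
    |c₀| ≤ B ^ 2 ∧ |c₁| ≤ B ^ 2 ∧ |c₂| ≤ B ^ 2 := by
  obtain ⟨e⟩ : Nonempty (Fin 4 ↪ α) := Function.Embedding.nonempty_of_card_le (by simpa using hcard)
  have hne : ∀ a b : Fin 4, a ≠ b → e a ≠ e b := fun a b hab h' => hab (e.injective h')
  have hmul : ∀ a b c d, |h a b * h c d| ≤ B ^ 2 := fun a b c d => by
    rw [abs_mul, sq]
    exact mul_le_mul (hB _ _) (hB _ _) (abs_nonneg _) ((abs_nonneg _).trans (hB a b))
  refine ⟨?_, ?_, ?_⟩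
  · rw [← H.disj (e 0) (e 1) (e 2) (e 3) (hne _ _ (by decide)) (hne _ _ (by decide))
      (hne _ _ (by decide)) (hne _ _ (by decide)) (hne _ _ (by decide)) (hne _ _ (by decide))]
    exact abs_favg_le fun σ => hmul _ _ _ _
  · rw [← H.share (e 0) (e 1) (e 2) (hne _ _ (by decide)) (hne _ _ (by decide))
      (hne _ _ (by decide))]
    exact abs_favg_le fun σ => hmul _ _ _ _
  · rw [← H.same (e 0) (e 1) (hne _ _ (by decide))]
    exact abs_favg_le fun σ => hmul _ _ _ _

/-- The pair moments of a symmetric array with vanishing off-diagonal row sums. -/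
theorem pairMoments_of_row_sum_zero {h : α → α → ℝ} (hsymm : ∀ a b, h a b = h b a)
    (hzero : ∀ a, ∑ b ∈ Finset.univ.erase a, h a b = 0) (hcard : 4 ≤ Fintype.card α) :
    ∃ c₂ : ℝ, PairMoments h (2 * c₂ / ((Fintype.card α - 2) * (Fintype.card α - 3)))
      (-c₂ / (Fintype.card α - 2)) c₂ := by
  have hN : (4 : ℝ) ≤ Fintype.card α := by exact_mod_cast hcard
  set N : ℝ := (Fintype.card α : ℝ)
  obtain ⟨i₀, j₀, hij₀⟩ := Fintype.exists_pair_of_one_lt_card (α := α) (by omega)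
  set c₂ := favg (fun σ : Perm α => h (σ i₀) (σ j₀) * h (σ i₀) (σ j₀)) with hc₂
  have hrow : ∀ (σ : Perm α) i, ∑ l ∈ Finset.univ.erase i, h (σ i) (σ l) = 0 := fun σ i => by
    rw [← hzero (σ i)]
    refine Finset.sum_bij (fun l _ => σ l) ?_ ?_ ?_ ?_
    · intro l hl; simpa using hl
    · intro a _ b _ hab; exact σ.injective hab
    · intro b hb
      refine ⟨σ.symm b, ?_, by simp⟩
      simp only [Finset.mem_erase, Finset.mem_univ, and_true, ne_eq] at hb ⊢
      rintro rfl; simp at hb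
    · intro l _; rfl
  have hsame : ∀ i j, i ≠ j → favg (fun σ : Perm α => h (σ i) (σ j) * h (σ i) (σ j)) = c₂ := by
    intro i j hij
    obtain ⟨π, h1, h2⟩ : ∃ π : Perm α, π i₀ = i ∧ π j₀ = j := by
      refine ⟨swap (swap i₀ i j₀) j * swap i₀ i, ?_, by simp⟩
      rw [Perm.mul_apply, swap_apply_left, swap_apply_of_ne_of_ne _ hij]
      intro h'
      have : swap i₀ i i₀ = swap i₀ i j₀ := by rw [swap_apply_left]; exact h'
      exact hij₀ ((swap i₀ i).injective this)
    rw [hc₂, ← favg_perm_relabel π h h i₀ j₀ i₀ j₀, h1, h2]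
  have hshare : ∀ i j l, i ≠ j → i ≠ l → j ≠ l →
      favg (fun σ : Perm α => h (σ i) (σ j) * h (σ i) (σ l)) = -c₂ / (N - 2) := by
    intro i j l hij hil hjl
    -- The vanishing row sum gives `c₂ + (N - 2) c₁ = 0`.
    have h0 : ∑ q ∈ Finset.univ.erase i,
        favg (fun σ : Perm α => h (σ i) (σ j) * h (σ i) (σ q)) = 0 := by
      rw [← favg_sum]
      simp_rw [← Finset.mul_sum, hrow, mul_zero]
      simp [favg]
    have hj : j ∈ Finset.univ.erase i := by simp [hij.symm]
    rw [← Finset.add_sum_erase _ _ hj, hsame _ _ hij, Finset.sum_congr rfl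
      (g := fun _ => favg (fun σ : Perm α => h (σ i) (σ j) * h (σ i) (σ l))) fun q hq => ?_] at h0
    · rw [Finset.sum_const, nsmul_eq_mul, Finset.card_erase_of_mem hj,
        Finset.card_erase_of_mem (Finset.mem_univ _), Finset.card_univ] at h0
      have e : ((Fintype.card α - 1 - 1 : ℕ) : ℝ) = N - 2 := by
        rw [Nat.cast_sub (by omega), Nat.cast_sub (by omega)]; push_cast; ring
      rw [e] at h0
      rw [eq_div_iff (by linarith)]
      linarith
    · simp only [Finset.mem_erase, Finset.mem_univ, and_true] at hq
      rw [← favg_perm_relabel (swap q l) h h i j i q]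
      rw [swap_apply_of_ne_of_ne hq.2.symm hil, swap_apply_of_ne_of_ne hq.1.symm hjl,
        swap_apply_left]
  have hdisj : ∀ i j l q, i ≠ j → i ≠ l → i ≠ q → j ≠ l → j ≠ q → l ≠ q →
      favg (fun σ : Perm α => h (σ i) (σ j) * h (σ l) (σ q))
        = 2 * c₂ / ((N - 2) * (N - 3)) := by
    intro i j l q hij hil hiq hjl hjq hlq
    -- Here the row sum over `r ≠ l` meets `i` and `j` once each, giving `2 c₁ + (N - 3) c₀ = 0`.
    have h0 : ∑ r ∈ Finset.univ.erase l,
        favg (fun σ : Perm α => h (σ i) (σ j) * h (σ l) (σ r)) = 0 := by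
      rw [← favg_sum]
      simp_rw [← Finset.mul_sum, hrow, mul_zero]
      simp [favg]
    have hi : i ∈ Finset.univ.erase l := by simp [hil]
    have hj : j ∈ (Finset.univ.erase l).erase i := by simp [hij.symm, hjl]
    have s1 : favg (fun σ : Perm α => h (σ i) (σ j) * h (σ l) (σ i)) = -c₂ / (N - 2) := by
      rw [← hshare i j l hij hil hjl]
      congr 1; funext σ; rw [hsymm (σ l)]
    have s2 : favg (fun σ : Perm α => h (σ i) (σ j) * h (σ l) (σ j)) = -c₂ / (N - 2) := by
      rw [← hshare j i l hij.symm hjl hil]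
      congr 1; funext σ; rw [hsymm (σ l), hsymm (σ i)]
    rw [← Finset.add_sum_erase _ _ hi, ← Finset.add_sum_erase _ _ hj, s1, s2, Finset.sum_congr rfl
      (g := fun _ => favg (fun σ : Perm α => h (σ i) (σ j) * h (σ l) (σ q))) fun r hr => ?_] at h0
    · rw [Finset.sum_const, nsmul_eq_mul, Finset.card_erase_of_mem hj, Finset.card_erase_of_mem hi,
        Finset.card_erase_of_mem (Finset.mem_univ _), Finset.card_univ] at h0
      have e : ((Fintype.card α - 1 - 1 - 1 : ℕ) : ℝ) = N - 3 := by
        rw [Nat.cast_sub (by omega), Nat.cast_sub (by omega), Nat.cast_sub (by omega)]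
        push_cast; ring
      rw [e] at h0
      have h2 : N - 2 ≠ 0 := by linarith
      have h3 : N - 3 ≠ 0 := by linarith
      field_simp at h0 ⊢
      linarith
    · simp only [Finset.mem_erase, Finset.mem_univ, and_true] at hr
      rw [← favg_perm_relabel (swap r q) h h i j l r]
      rw [swap_apply_of_ne_of_ne hr.2.1.symm hiq, swap_apply_of_ne_of_ne hr.1.symm hjq,
        swap_apply_of_ne_of_ne hr.2.2.symm hlq, swap_apply_left]
  have hmean : ∀ i j, i ≠ j → favg (fun σ : Perm α => h (σ i) (σ j)) = 0 := by
    intro i j hij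
    have h0 : ∑ q ∈ Finset.univ.erase i, favg (fun σ : Perm α => h (σ i) (σ q)) = 0 := by
      rw [← favg_sum]
      simp_rw [hrow]
      simp [favg]
    rw [Finset.sum_congr rfl (g := fun _ => favg (fun σ : Perm α => h (σ i) (σ j)))
      fun q hq => ?_] at h0
    · rw [Finset.sum_const, nsmul_eq_mul, Finset.card_erase_of_mem (Finset.mem_univ _),
        Finset.card_univ] at h0
      refine (mul_eq_zero.1 h0).resolve_left ?_
      have : Fintype.card α - 1 ≠ 0 := by omega
      exact_mod_cast this
    · simp only [Finset.mem_erase, Finset.mem_univ, and_true] at hq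
      rw [← favg_perm_mul_right (swap q j)]
      simp only [Perm.mul_apply, swap_apply_of_ne_of_ne hq.symm hij, swap_apply_left]
  exact ⟨c₂, hsymm, hmean, hsame, hshare, hdisj⟩

/-- The pair moments of `u a + u b` for a centred `u`. -/
theorem pairMoments_add {u : α → ℝ} (hu : ∑ a, u a = 0) {v w : ℝ}
    (hv : v = (Fintype.card α : ℝ)⁻¹ * ∑ a, u a ^ 2) (hw : w = -v / (Fintype.card α - 1)) :
    PairMoments (fun a b => u a + u b) (4 * w) (v + 3 * w) (2 * v + 2 * w) := by
  have hsq : ∀ i, favg (fun σ : Perm α => u (σ i) * u (σ i)) = v := fun i => by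
    rw [hv, ← favg_perm_apply (fun a => u a ^ 2) i]; simp_rw [sq]
  have hne : ∀ i j, i ≠ j → favg (fun σ : Perm α => u (σ i) * u (σ j)) = w := fun i j hij => by
    rw [favg_perm_apply_mul_apply hu hij, hw, hv]
  have hexp : ∀ i j l q, favg (fun σ : Perm α => (u (σ i) + u (σ j)) * (u (σ l) + u (σ q)))
      = favg (fun σ : Perm α => u (σ i) * u (σ l)) + favg (fun σ : Perm α => u (σ i) * u (σ q))
        + (favg (fun σ : Perm α => u (σ j) * u (σ l))
          + favg (fun σ : Perm α => u (σ j) * u (σ q))) := fun i j l q => by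
    rw [← favg_add, ← favg_add, ← favg_add]
    congr 1; funext σ; ring
  have hone : ∀ i, favg (fun σ : Perm α => u (σ i)) = 0 := fun i => by
    rw [favg_perm_apply, hu, mul_zero]
  refine ⟨fun a b => add_comm _ _, fun i j _ => by rw [favg_add, hone, hone, add_zero],
    fun i j hij => ?_, fun i j l hij hil hjl => ?_,
    fun i j l q hij hil hiq hjl hjq hlq => ?_⟩
  · rw [hexp, hsq, hsq, hne _ _ hij, hne _ _ hij.symm]; ring
  · rw [hexp, hsq, hne _ _ hil, hne _ _ hij.symm, hne _ _ hjl]; ring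
  · rw [hexp, hne _ _ hil, hne _ _ hiq, hne _ _ hjl, hne _ _ hjq]; ring

end PermMoments

/-- The effect of a transposition on `∑ A i j * Φ (σ i) (σ j)`. -/
theorem abs_sum_mul_swap_sub_le {α : Type*} [Fintype α] [DecidableEq α] {A Φ : α → α → ℝ}
    {k C b : ℝ} (hA : ∀ i j, 0 ≤ A i j) (hrow : ∀ i, ∑ j, A i j ≤ k) (hcol : ∀ j, ∑ i, A i j ≤ C)
    (hb : 0 ≤ b) (hΦ : ∀ i j, |Φ i j| ≤ b) (u v : α) (σ : Equiv.Perm α) :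
    |∑ i, ∑ j, A i j * Φ ((σ * Equiv.swap u v) i) ((σ * Equiv.swap u v) j)
      - ∑ i, ∑ j, A i j * Φ (σ i) (σ j)| ≤ 4 * b * (k + C) := by
  -- Only edges with an endpoint in `{u, v}` change, each by at most `2 b` times its weight; two
  -- rows and two columns contain them all.
  have hterm : ∀ i j, |A i j * Φ ((σ * Equiv.swap u v) i) ((σ * Equiv.swap u v) j)
      - A i j * Φ (σ i) (σ j)| ≤ 2 * b * ((if i = u then A i j else 0) + (if i = v then A i j else 0)
        + (if j = u then A i j else 0) + (if j = v then A i j else 0)) := by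
    intro i j
    have hA' := hA i j
    by_cases h : i = u ∨ i = v ∨ j = u ∨ j = v
    · have h1 : A i j ≤ (if i = u then A i j else 0) + (if i = v then A i j else 0)
        + (if j = u then A i j else 0) + (if j = v then A i j else 0) := by
        split_ifs <;> first | linarith | (exfalso; tauto)
      rw [← mul_sub, abs_mul, abs_of_nonneg hA']
      have h2 : |Φ ((σ * Equiv.swap u v) i) ((σ * Equiv.swap u v) j) - Φ (σ i) (σ j)| ≤ 2 * b :=
        (abs_sub _ _).trans ((add_le_add (hΦ _ _) (hΦ _ _)).trans_eq (two_mul b).symm)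
      calc _ ≤ A i j * (2 * b) := mul_le_mul_of_nonneg_left h2 hA'
        _ = 2 * b * A i j := mul_comm _ _
        _ ≤ _ := mul_le_mul_of_nonneg_left h1 (by linarith)
    · push Not at h
      obtain ⟨h1, h2, h3, h4⟩ := h
      simp [Equiv.swap_apply_of_ne_of_ne h1 h2, Equiv.swap_apply_of_ne_of_ne h3 h4, h1, h2, h3, h4]
  rw [← Finset.sum_sub_distrib]
  simp_rw [← Finset.sum_sub_distrib]
  have e1 : ∀ u, ∑ i, ∑ j, (if i = u then A i j else 0) = ∑ j, A u j := fun u => by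
    rw [Finset.sum_comm]; simp
  have e2 : ∀ u, ∑ i, ∑ j, (if j = u then A i j else 0) = ∑ i, A i u := fun u => by simp
  calc _ ≤ ∑ i, ∑ j, |A i j * Φ ((σ * Equiv.swap u v) i) ((σ * Equiv.swap u v) j)
      - A i j * Φ (σ i) (σ j)| :=
        (Finset.abs_sum_le_sum_abs _ _).trans
          (Finset.sum_le_sum fun i _ => Finset.abs_sum_le_sum_abs _ _)
    _ ≤ _ := Finset.sum_le_sum fun i _ => Finset.sum_le_sum fun j _ => hterm i j
    _ = 2 * b * (∑ j, A u j + ∑ j, A v j + ∑ i, A i u + ∑ i, A i v) := by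
        simp_rw [← Finset.mul_sum, Finset.sum_add_distrib, e1, e2]
    _ ≤ 2 * b * (k + k + C + C) :=
        mul_le_mul_of_nonneg_left (by linarith [hrow u, hrow v, hcol u, hcol v]) (by linarith)
    _ = _ := by ring

/-! ### Deterministic properties of the nearest neighbour graph -/

section NearestNeighbours

variable {E : Type*} [MetricSpace E]

/-- No point of the sequence is equidistant from two others. -/
def NoTies (y : ℕ → E) : Prop :=
  ∀ i j l, i ≠ j → i ≠ l → j ≠ l → dist (y i) (y j) ≠ dist (y i) (y l)

theorem knnInd_eq (S : Finset ℕ) (y : ℕ → E) (k i j : ℕ) :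
    knnInd S y k i j = if i ∈ S ∧ j ∈ S ∧ j ≠ i ∧ closerCount S y i j < k then 1 else 0 := by
  unfold knnInd nnInd
  by_cases h : i ∈ S ∧ j ∈ S ∧ j ≠ i
  · simp only [h, true_and, ne_eq, not_false_eq_true, Finset.sum_ite_eq, Finset.mem_Icc]
    congr 1
    simp
  · rw [if_neg fun h' => h ⟨h'.1, h'.2.1, h'.2.2.1⟩]
    exact Finset.sum_eq_zero fun r _ => if_neg fun h' => h ⟨h'.1, h'.2.1, h'.2.2.1⟩

theorem knnInd_nonneg (S : Finset ℕ) (y : ℕ → E) (k i j : ℕ) : 0 ≤ knnInd S y k i j := by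
  rw [knnInd_eq]; split_ifs <;> norm_num

theorem knnInd_le_one (S : Finset ℕ) (y : ℕ → E) (k i j : ℕ) : knnInd S y k i j ≤ 1 := by
  rw [knnInd_eq]; split_ifs <;> norm_num

theorem knnInd_self (S : Finset ℕ) (y : ℕ → E) (k i : ℕ) : knnInd S y k i i = 0 := by
  rw [knnInd_eq]; simp

theorem knnInd_mul_self (S : Finset ℕ) (y : ℕ → E) (k i j : ℕ) :
    knnInd S y k i j * knnInd S y k i j = knnInd S y k i j := by
  rw [knnInd_eq]; split_ifs <;> norm_num

theorem closerCount_congr {S : Finset ℕ} {y y' : ℕ → E} (h : ∀ i ∈ S, y i = y' i) {i j : ℕ}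
    (hi : i ∈ S) (hj : j ∈ S) : closerCount S y i j = closerCount S y' i j := by
  unfold closerCount
  congr 1
  refine Finset.filter_congr fun l hl => ?_
  rw [h i hi, h j hj, h l hl]

theorem knnInd_congr {S : Finset ℕ} {y y' : ℕ → E} (h : ∀ i ∈ S, y i = y' i) (k i j : ℕ) :
    knnInd S y k i j = knnInd S y' k i j := by
  rw [knnInd_eq, knnInd_eq]
  by_cases h' : i ∈ S ∧ j ∈ S
  · rw [closerCount_congr h h'.1 h'.2]
  · rw [if_neg fun h2 => h' ⟨h2.1, h2.2.1⟩, if_neg fun h2 => h' ⟨h2.1, h2.2.1⟩]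

theorem closerCount_map (e : ℕ ↪ ℕ) (S : Finset ℕ) (y : ℕ → E) (i j : ℕ) :
    closerCount (S.map e) y (e i) (e j) = closerCount S (fun m => y (e m)) i j := by
  unfold closerCount
  rw [Finset.filter_map, Finset.card_map]
  congr 1
  refine Finset.filter_congr fun l _ => ?_
  simp

theorem knnInd_map (e : ℕ ↪ ℕ) (S : Finset ℕ) (y : ℕ → E) (k i j : ℕ) :
    knnInd (S.map e) y k (e i) (e j) = knnInd S (fun m => y (e m)) k i j := by
  rw [knnInd_eq, knnInd_eq, closerCount_map]
  simp

theorem closerCount_lt_of_dist_lt {S : Finset ℕ} {y : ℕ → E} {a i b : ℕ} (hi : i ∈ S)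
    (hia : i ≠ a) (h : dist (y a) (y i) < dist (y a) (y b)) :
    closerCount S y a i < closerCount S y a b := by
  refine Finset.card_lt_card (Finset.ssubset_iff.2 ⟨i, ?_, ?_⟩)
  · simp
  · intro l hl
    rw [Finset.mem_insert] at hl
    rcases hl with rfl | hl
    · simp [hi, hia, h]
    · simp only [Finset.mem_filter] at hl ⊢
      exact ⟨hl.1, hl.2.1, hl.2.2.trans h⟩

/-- Without ties, one of two points is strictly closer, and the closer point is itself counted for
the farther one. -/
theorem closerCount_injOn {S : Finset ℕ} {y : ℕ → E} (hy : NoTies y) (i : ℕ) :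
    Set.InjOn (closerCount S y i) (S.erase i : Finset ℕ) := by
  intro j hj l hl h
  simp only [Finset.coe_erase, Set.mem_sdiff, Finset.mem_coe, Set.mem_singleton_iff] at hj hl
  by_contra hne
  rcases lt_or_gt_of_ne (hy i j l (Ne.symm hj.2) (Ne.symm hl.2) hne) with h' | h'
  · exact (closerCount_lt_of_dist_lt hj.1 hj.2 h').ne h
  · exact (closerCount_lt_of_dist_lt hl.1 hl.2 h').ne h.symm

theorem sum_knnInd_eq_card {S : Finset ℕ} (y : ℕ → E) (k : ℕ) {i : ℕ} (hi : i ∈ S) :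
    ∑ j ∈ S, knnInd S y k i j = (((S.erase i).filter fun j => closerCount S y i j < k).card : ℝ) := by
  simp_rw [knnInd_eq]
  rw [Finset.sum_boole]
  congr 2
  ext j
  simp only [Finset.mem_filter, Finset.mem_erase, hi, true_and]
  tauto

theorem sum_knnInd_le {S : Finset ℕ} {y : ℕ → E} (hy : NoTies y) (k i : ℕ) :
    ∑ j ∈ S, knnInd S y k i j ≤ k := by
  by_cases hi : i ∈ S
  · rw [sum_knnInd_eq_card y k hi]
    have := Finset.card_le_card_of_injOn (s := (S.erase i).filter fun j => closerCount S y i j < k)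
      (t := Finset.range k) (closerCount S y i)
      (fun j hj => by simpa using (Finset.mem_filter.1 hj).2)
      ((closerCount_injOn hy i).mono (Finset.coe_subset.2 (Finset.filter_subset _ _)))
    rw [Finset.card_range] at this
    exact_mod_cast this
  · refine (Finset.sum_nonpos fun j _ => ?_).trans (Nat.cast_nonneg k)
    rw [knnInd_eq, if_neg fun h => hi h.1]

/-- Injectivity forces the counts to fill `0, …, S.card - 2`, so each rank below `k` is taken
exactly once. Constant out-degree is what makes the conditional mean deterministic. -/
theorem sum_knnInd_eq {S : Finset ℕ} {y : ℕ → E} (hy : NoTies y) {k i : ℕ} (hi : i ∈ S)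
    (hk : k < S.card) : ∑ j ∈ S, knnInd S y k i j = k := by
  rw [sum_knnInd_eq_card y k hi]
  have hinj := closerCount_injOn (S := S) hy i
  have hsub : (S.erase i).image (closerCount S y i) ⊆ Finset.range (S.erase i).card := by
    intro r hr
    obtain ⟨j, hj, rfl⟩ := Finset.mem_image.1 hr
    rw [Finset.mem_range]
    refine Finset.card_lt_card (Finset.ssubset_iff.2 ⟨j, by simp, fun l hl => ?_⟩)
    rcases Finset.mem_insert.1 hl with rfl | hl
    · exact hj
    · rw [Finset.mem_filter] at hl
      exact Finset.mem_erase.2 ⟨hl.2.1, hl.1⟩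
  have himg : (S.erase i).image (closerCount S y i) = Finset.range (S.erase i).card :=
    Finset.eq_of_subset_of_card_le hsub (by rw [Finset.card_range, Finset.card_image_of_injOn hinj])
  have : ((S.erase i).filter fun j => closerCount S y i j < k).image (closerCount S y i)
      = Finset.range k := by
    ext r
    simp only [Finset.mem_image, Finset.mem_filter, Finset.mem_range]
    constructor
    · rintro ⟨j, ⟨-, h⟩, rfl⟩; exact h
    · intro hr
      have : r ∈ (S.erase i).image (closerCount S y i) := by
        rw [himg, Finset.mem_range, Finset.card_erase_of_mem hi]; omega
      obtain ⟨j, hj, rfl⟩ := Finset.mem_image.1 this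
      exact ⟨j, ⟨hj, hr⟩, rfl⟩
  rw [← Finset.card_image_of_injOn (hinj.mono (Finset.coe_subset.2 (Finset.filter_subset _ _))), this, Finset.card_range]

/-- Removing a point that is not among the `k` nearest neighbours of `a` does not change the
nearest neighbours of `a`. -/
theorem knnInd_erase_eq {S : Finset ℕ} {y : ℕ → E} {k i a : ℕ} (hi : i ∈ S) (ha : a ∈ S)
    (hai : a ≠ i) (h : knnInd S y k a i = 0) (b : ℕ) :
    knnInd (S.erase i) y k a b = knnInd S y k a b := by
  by_cases hbi : b = i
  · subst hbi
    rw [h, knnInd_eq, if_neg (by simp)]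
  by_cases hb : b ∈ S ∧ b ≠ a
  swap
  · rw [knnInd_eq, knnInd_eq, if_neg, if_neg]
    · exact fun h' => hb ⟨h'.2.1, h'.2.2.1⟩
    · exact fun h' => hb ⟨Finset.mem_of_mem_erase h'.2.1, h'.2.2.1⟩
  have hk : k ≤ closerCount S y a i := by
    rw [knnInd_eq] at h
    by_contra hlt
    rw [if_pos ⟨ha, hi, hai.symm, not_le.1 hlt⟩] at h
    exact one_ne_zero h
  have hiff : closerCount (S.erase i) y a b < k ↔ closerCount S y a b < k := by
    classical
    have he : closerCount (S.erase i) y a b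
        = ((S.filter fun l => l ≠ a ∧ dist (y a) (y l) < dist (y a) (y b)).erase i).card := by
      unfold closerCount
      rw [Finset.filter_erase]
    by_cases hd : dist (y a) (y i) < dist (y a) (y b)
    -- If `i` is closer to `a` than `b` is, then `b` has count at least `k + 1`; losing `i` lowers
    -- it by at most one, so `b` stays outside the first `k`.
    · have h1 := closerCount_lt_of_dist_lt hi hai.symm hd
      have h2 : closerCount S y a b - 1 ≤ closerCount (S.erase i) y a b := by
        rw [he]
        convert Finset.pred_card_le_card_erase using 2
        unfold closerCount
        congr
      constructor <;> intro h3 <;> omega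
    · have : closerCount (S.erase i) y a b = closerCount S y a b := by
        rw [he, Finset.erase_eq_of_notMem (by simp [hd])]
        unfold closerCount
        congr
      rw [this]
  rw [knnInd_eq, knnInd_eq]
  simp only [Finset.mem_erase, hai, hbi, ne_eq, not_false_eq_true, true_and, hiff]

/-- Number of ordered pairs of mutual nearest neighbours. -/
noncomputable def mutualCount (S : Finset ℕ) (k : ℕ) (y : ℕ → E) : ℝ :=
  ∑ i ∈ S, ∑ j ∈ S, knnInd S y k i j * knnInd S y k j i

/-- Sum of the squared in-degrees. -/
noncomputable def inDegSq (S : Finset ℕ) (k : ℕ) (y : ℕ → E) : ℝ :=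
  ∑ j ∈ S, (∑ i ∈ S, knnInd S y k i j) ^ 2

/-- Every in-degree of the nearest neighbour graph on `S` is at most `C`. -/
def InDegLE (S : Finset ℕ) (k : ℕ) (C : ℝ) (y : ℕ → E) : Prop :=
  ∀ j ∈ S, ∑ i ∈ S, knnInd S y k i j ≤ C

theorem knnInd_eq_zero_of_left_notMem {S : Finset ℕ} {y : ℕ → E} {k i j : ℕ} (h : i ∉ S) :
    knnInd S y k i j = 0 := by
  rw [knnInd_eq, if_neg fun h' => h h'.1]

theorem knnInd_eq_zero_of_right_notMem {S : Finset ℕ} {y : ℕ → E} {k i j : ℕ} (h : j ∉ S) :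
    knnInd S y k i j = 0 := by
  rw [knnInd_eq, if_neg fun h' => h h'.2.1]

/-! ### Stability of graph statistics under deletion of a point -/

section LeaveOneOut

variable {S : Finset ℕ} {y : ℕ → E} {k : ℕ} {C : ℝ} {i : ℕ}

open Classical in
theorem knnInd_sub_erase_eq_zero (hi : i ∈ S) {a : ℕ} (ha : a ∈ S)
    (h : a ∉ S.filter fun a => a = i ∨ knnInd S y k a i ≠ 0) (b : ℕ) :
    knnInd (S.erase i) y k a b = knnInd S y k a b := by
  simp only [Finset.mem_filter, ha, true_and, not_or, not_not] at h
  exact knnInd_erase_eq hi ha h.1 h.2 b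

open Classical in
theorem card_changed_le (hi : i ∈ S) (hC : InDegLE S k C y) :
    ((S.filter fun a => a = i ∨ knnInd S y k a i ≠ 0).card : ℝ) ≤ C + 1 := by
  have : ((S.filter fun a => a = i ∨ knnInd S y k a i ≠ 0).card : ℝ)
      ≤ ∑ a ∈ S, ((if a = i then 1 else 0) + knnInd S y k a i) := by
    rw [← Finset.sum_boole]
    refine Finset.sum_le_sum fun a _ => ?_
    by_cases h1 : a = i
    · simp [h1, knnInd_nonneg]
    · rw [knnInd_eq]; simp only [h1, if_false, zero_add, false_or]
      split_ifs <;> simp_all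
  refine this.trans ?_
  rw [Finset.sum_add_distrib]
  simp only [Finset.sum_ite_eq', hi, if_true]
  linarith [hC i hi]

/-- Only the rows of `i` and of its in-neighbours can change, at most `C + 1` of them, and each has
at most `k` ones before and after. -/
theorem sum_abs_sub_erase_le (hy : NoTies y) (hi : i ∈ S) (hC : InDegLE S k C y) :
    ∑ a ∈ S, ∑ b ∈ S, |knnInd S y k a b - knnInd (S.erase i) y k a b| ≤ (C + 1) * (2 * k) := by
  classical
  have hrow : ∀ a ∈ S, ∑ b ∈ S, |knnInd S y k a b - knnInd (S.erase i) y k a b|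
      ≤ if a ∈ S.filter (fun a => a = i ∨ knnInd S y k a i ≠ 0) then (2 * k : ℝ) else 0 := by
    intro a ha
    split_ifs with h
    · have h1 := sum_knnInd_le (S := S) hy k a
      have h2 := sum_knnInd_le (S := S.erase i) hy k a
      have h3 : ∑ b ∈ S, knnInd (S.erase i) y k a b = ∑ b ∈ S.erase i, knnInd (S.erase i) y k a b := by
        rw [← Finset.add_sum_erase _ _ hi, knnInd_eq_zero_of_right_notMem (by simp), zero_add]
      calc _ ≤ ∑ b ∈ S, (knnInd S y k a b + knnInd (S.erase i) y k a b) :=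
            Finset.sum_le_sum fun b _ => (abs_sub _ _).trans
              (by rw [abs_of_nonneg (knnInd_nonneg _ _ _ _ _), abs_of_nonneg (knnInd_nonneg _ _ _ _ _)])
        _ ≤ _ := by rw [Finset.sum_add_distrib, h3]; linarith
    · refine le_of_eq (Finset.sum_eq_zero fun b _ => ?_)
      rw [knnInd_sub_erase_eq_zero hi ha h, sub_self, abs_zero]
  refine (Finset.sum_le_sum hrow).trans ?_
  rw [← Finset.sum_filter, Finset.sum_const, nsmul_eq_mul]
  refine mul_le_mul_of_nonneg_right ?_ (by positivity)
  refine le_trans ?_ (card_changed_le hi hC)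
  exact_mod_cast Finset.card_le_card fun a ha => (Finset.mem_filter.1 ha).2

theorem mutualCount_erase (hi : i ∈ S) : mutualCount (S.erase i) k y
    = ∑ a ∈ S, ∑ b ∈ S, knnInd (S.erase i) y k a b * knnInd (S.erase i) y k b a := by
  rw [mutualCount, ← Finset.add_sum_erase _ _ hi]
  simp_rw [knnInd_eq_zero_of_left_notMem (y := y) (k := k) (Finset.notMem_erase i S), zero_mul]
  rw [Finset.sum_const_zero, zero_add]
  refine Finset.sum_congr rfl fun a _ => ?_
  rw [← Finset.add_sum_erase S _ hi,
    knnInd_eq_zero_of_right_notMem (Finset.notMem_erase i S), zero_mul, zero_add]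

theorem inDegSq_erase (hi : i ∈ S) : inDegSq (S.erase i) k y
    = ∑ b ∈ S, (∑ a ∈ S, knnInd (S.erase i) y k a b) ^ 2 := by
  rw [inDegSq, ← Finset.add_sum_erase _ _ hi]
  simp_rw [knnInd_eq_zero_of_right_notMem (y := y) (k := k) (Finset.notMem_erase i S)]
  rw [Finset.sum_const_zero, sq, zero_mul, zero_add]
  refine Finset.sum_congr rfl fun a _ => ?_
  rw [← Finset.add_sum_erase S _ hi,
    knnInd_eq_zero_of_left_notMem (Finset.notMem_erase i S), zero_add]

theorem abs_mutualCount_sub_erase_le (hy : NoTies y) (hi : i ∈ S) (hC : InDegLE S k C y) :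
    |mutualCount S k y - mutualCount (S.erase i) k y| ≤ 4 * k * (C + 1) := by
  have key := sum_abs_sub_erase_le hy hi hC
  rw [mutualCount_erase hi, mutualCount, ← Finset.sum_sub_distrib]
  simp_rw [← Finset.sum_sub_distrib]
  calc _ ≤ ∑ a ∈ S, ∑ b ∈ S, (|knnInd S y k a b - knnInd (S.erase i) y k a b|
          + |knnInd S y k b a - knnInd (S.erase i) y k b a|) := by
        refine (Finset.abs_sum_le_sum_abs _ _).trans (Finset.sum_le_sum fun a _ =>
          (Finset.abs_sum_le_sum_abs _ _).trans (Finset.sum_le_sum fun b _ => ?_))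
        have e : knnInd S y k a b * knnInd S y k b a
            - knnInd (S.erase i) y k a b * knnInd (S.erase i) y k b a
          = (knnInd S y k a b - knnInd (S.erase i) y k a b) * knnInd S y k b a
            + knnInd (S.erase i) y k a b * (knnInd S y k b a - knnInd (S.erase i) y k b a) := by ring
        rw [e]
        refine (abs_add_le _ _).trans (add_le_add ?_ ?_)
        · rw [abs_mul, abs_of_nonneg (knnInd_nonneg S y k b a)]
          exact mul_le_of_le_one_right (abs_nonneg _) (knnInd_le_one _ _ _ _ _)
        · rw [abs_mul, abs_of_nonneg (knnInd_nonneg (S.erase i) y k a b)]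
          exact mul_le_of_le_one_left (abs_nonneg _) (knnInd_le_one _ _ _ _ _)
    _ = ∑ a ∈ S, ∑ b ∈ S, |knnInd S y k a b - knnInd (S.erase i) y k a b|
          + ∑ a ∈ S, ∑ b ∈ S, |knnInd S y k a b - knnInd (S.erase i) y k a b| := by
        simp_rw [Finset.sum_add_distrib]
        congr 1
        rw [Finset.sum_comm]
    _ ≤ _ := by linarith

theorem abs_inDegSq_sub_erase_le (hy : NoTies y) (hi : i ∈ S) (hC : InDegLE S k C y) :
    |inDegSq S k y - inDegSq (S.erase i) k y| ≤ (3 * C + 1) * (2 * k * (C + 1)) := by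
  classical
  have key := sum_abs_sub_erase_le hy hi hC
  have hnn : ∀ T b, 0 ≤ ∑ a ∈ S, knnInd T y k a b := fun T b =>
    Finset.sum_nonneg fun a _ => knnInd_nonneg _ _ _ _ _
  have hC0 : 0 ≤ C := (hnn S i).trans (hC i hi)
  -- No degree bound is assumed for the smaller graph: the at most `C + 1` changed rows add at most
  -- one each to the old in-degree `C`. Together with `C` this yields the factor `3 * C + 1` for a
  -- difference of squares.
  have hdeg : ∀ b ∈ S, ∑ a ∈ S, knnInd (S.erase i) y k a b ≤ 2 * C + 1 := fun b hb => by
    have h1 : ∑ a ∈ S, knnInd (S.erase i) y k a b ≤ ∑ a ∈ S, (knnInd S y k a b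
        + if a ∈ S.filter (fun a => a = i ∨ knnInd S y k a i ≠ 0) then (1 : ℝ) else 0) := by
      refine Finset.sum_le_sum fun a ha => ?_
      split_ifs with h
      · linarith [knnInd_le_one (S.erase i) y k a b, knnInd_nonneg S y k a b]
      · rw [knnInd_sub_erase_eq_zero hi ha h, add_zero]
    rw [Finset.sum_add_distrib, Finset.sum_boole] at h1
    have h2 : ((S.filter fun a => a ∈ S.filter fun a => a = i ∨ knnInd S y k a i ≠ 0).card : ℝ)
        ≤ C + 1 := le_trans
      (by exact_mod_cast Finset.card_le_card fun a ha => (Finset.mem_filter.1 ha).2)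
      (card_changed_le hi hC)
    linarith [hC b hb]
  rw [inDegSq_erase hi, inDegSq, ← Finset.sum_sub_distrib]
  calc _ ≤ ∑ b ∈ S, (3 * C + 1) * ∑ a ∈ S, |knnInd S y k a b - knnInd (S.erase i) y k a b| := by
        refine (Finset.abs_sum_le_sum_abs _ _).trans (Finset.sum_le_sum fun b hb => ?_)
        rw [sq_sub_sq, abs_mul]
        refine mul_le_mul ?_ ?_ (abs_nonneg _) (by linarith)
        · rw [abs_of_nonneg (add_nonneg (hnn _ _) (hnn _ _))]
          linarith [hC b hb, hdeg b hb]
        · rw [← Finset.sum_sub_distrib]; exact Finset.abs_sum_le_sum_abs _ _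
    _ = (3 * C + 1) * ∑ a ∈ S, ∑ b ∈ S, |knnInd S y k a b - knnInd (S.erase i) y k a b| := by
        rw [← Finset.mul_sum, Finset.sum_comm]
    _ ≤ (3 * C + 1) * ((C + 1) * (2 * k)) := mul_le_mul_of_nonneg_left key (by linarith)
    _ = _ := by ring

end LeaveOneOut

/-- A crude bound without any degree assumption, used only for boundedness and integrability. -/
theorem abs_mutualCount_le (S : Finset ℕ) (k : ℕ) (y : ℕ → E) :
    |mutualCount S k y| ≤ (S.card : ℝ) * S.card := by
  rw [mutualCount, abs_of_nonneg (Finset.sum_nonneg fun i _ => Finset.sum_nonneg fun j _ =>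
    mul_nonneg (knnInd_nonneg _ _ _ _ _) (knnInd_nonneg _ _ _ _ _))]
  rw [← nsmul_eq_mul, ← nsmul_one S.card]
  refine Finset.sum_le_card_nsmul _ _ _ fun i _ => Finset.sum_le_card_nsmul _ _ _ fun j _ =>
    mul_le_one₀ (knnInd_le_one _ _ _ _ _) (knnInd_nonneg _ _ _ _ _) (knnInd_le_one _ _ _ _ _)

theorem abs_inDegSq_le (S : Finset ℕ) (k : ℕ) (y : ℕ → E) :
    |inDegSq S k y| ≤ (S.card : ℝ) * (S.card : ℝ) ^ 2 := by
  rw [inDegSq, abs_of_nonneg (Finset.sum_nonneg fun i _ => sq_nonneg _), ← nsmul_eq_mul]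
  refine Finset.sum_le_card_nsmul _ _ _ fun j _ => ?_
  refine pow_le_pow_left₀ (Finset.sum_nonneg fun a _ => knnInd_nonneg _ _ _ _ _) ?_ 2
  rw [← nsmul_one S.card]
  exact Finset.sum_le_card_nsmul _ _ _ fun i _ => knnInd_le_one _ _ _ _ _

/-! ### Measurability of graph statistics -/

section Measurability

variable [MeasurableSpace E]

theorem measurable_knnInd
    (hdist : Measurable fun p : E × E => dist p.1 p.2) (S : Finset ℕ) (k i j : ℕ) :
    Measurable fun y : ℕ → E => knnInd S y k i j := by
  have hd : ∀ a b : ℕ, Measurable fun y : ℕ → E => dist (y a) (y b) := fun a b =>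
    hdist.comp ((measurable_pi_apply (X := fun _ : ℕ => E) a).prodMk (measurable_pi_apply b))
  have hc : Measurable fun y : ℕ → E => closerCount S y i j := by
    unfold closerCount
    simp_rw [Finset.card_filter]
    refine Finset.measurable_sum _ fun l _ => ?_
    by_cases hl : l = i
    · simp [hl]
    · simp only [ne_eq, hl, not_false_eq_true, true_and]
      exact Measurable.ite (measurableSet_lt (hd _ _) (hd _ _)) measurable_const measurable_const
  simp_rw [knnInd_eq]
  by_cases h : i ∈ S ∧ j ∈ S ∧ j ≠ i
  · simp only [h, true_and, ne_eq, not_false_eq_true]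
    exact Measurable.ite (measurableSet_lt hc measurable_const) measurable_const measurable_const
  · have : ∀ y : ℕ → E, ¬ (i ∈ S ∧ j ∈ S ∧ j ≠ i ∧ closerCount S y i j < k) :=
      fun y h' => h ⟨h'.1, h'.2.1, h'.2.2.1⟩
    simp only [this, if_false]
    exact measurable_const

theorem measurable_mutualCount
    (hdist : Measurable fun p : E × E => dist p.1 p.2) (S : Finset ℕ) (k : ℕ) :
    Measurable fun y : ℕ → E => mutualCount S k y :=
  Finset.measurable_sum _ fun i _ => Finset.measurable_sum _ fun j _ =>
    (measurable_knnInd hdist S k i j).mul (measurable_knnInd hdist S k j i)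

theorem measurable_inDegSq
    (hdist : Measurable fun p : E × E => dist p.1 p.2) (S : Finset ℕ) (k : ℕ) :
    Measurable fun y : ℕ → E => inDegSq S k y :=
  Finset.measurable_sum _ fun j _ =>
    (Finset.measurable_sum _ fun i _ => measurable_knnInd hdist S k i j).pow_const 2

end Measurability

theorem mutualCount_congr {S : Finset ℕ} {y y' : ℕ → E} (h : ∀ i ∈ S, y i = y' i) (k : ℕ) :
    mutualCount S k y = mutualCount S k y' := by
  simp_rw [mutualCount, knnInd_congr h]

theorem inDegSq_congr {S : Finset ℕ} {y y' : ℕ → E} (h : ∀ i ∈ S, y i = y' i) (k : ℕ) :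
    inDegSq S k y = inDegSq S k y' := by
  simp_rw [inDegSq, knnInd_congr h]

theorem inDegLE_map {e : ℕ ↪ ℕ} {S : Finset ℕ} {y : ℕ → E} {k : ℕ} {C : ℝ}
    (h : InDegLE S k C fun m => y (e m)) : InDegLE (S.map e) k C y := by
  intro j hj
  obtain ⟨j, hj', rfl⟩ := Finset.mem_map.1 hj
  rw [Finset.sum_map]
  simp_rw [knnInd_map]
  exact h j hj'

end NearestNeighbours

/-! ### Borel–Cantelli and comparison of normalizations -/

section Sequences

variable {Ω : Type*} [MeasurableSpace Ω] {μ : Measure Ω} [IsFiniteMeasure μ]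

/-- Sub-Gaussian tails with variance proxy of order `L` give an almost sure bound of order
`√(L log L)`. -/
theorem ae_eventually_abs_le_sqrt_mul_log {X : ℕ → Ω → ℝ} {c : ℝ} (hc : 0 < c)
    (h : ∀ᶠ L : ℕ in atTop, ∀ r : ℝ, 0 ≤ r →
      μ.real {ω | r ≤ |X L ω|} ≤ 2 * Real.exp (-r ^ 2 / (2 * (c ^ 2 * L)))) :
    ∀ᵐ ω ∂μ, ∀ᶠ L : ℕ in atTop, |X L ω| ≤ 2 * c * √(L * Real.log L) := by
  obtain ⟨N, hN⟩ := eventually_atTop.1 h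
  -- At this threshold the exponent is `-2 log m`, so the tail is the summable `2 / m²`. The shift
  -- by `N + 1` also keeps `m ≥ 1`.
  have hbound : ∀ L : ℕ, μ {ω | 2 * c * √(((L + (N + 1) : ℕ) : ℝ) * Real.log (L + (N + 1) : ℕ))
      ≤ |X (L + (N + 1)) ω|} ≤ ENNReal.ofReal (2 * (1 / ((L + (N + 1) : ℕ) : ℝ) ^ 2)) := fun L => by
    set m := L + (N + 1) with hm
    have hm1 : (1 : ℝ) ≤ m := by exact_mod_cast (by omega : 1 ≤ m)
    have hlog : 0 ≤ Real.log m := Real.log_nonneg hm1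
    have h1 := hN m (by omega) (2 * c * √((m : ℝ) * Real.log m)) (by positivity)
    rw [← ENNReal.ofReal_toReal (measure_ne_top μ _)]
    refine ENNReal.ofReal_le_ofReal (h1.trans (le_of_eq ?_))
    congr 1
    rw [mul_pow, Real.sq_sqrt (by positivity)]
    have : -((2 * c) ^ 2 * (m * Real.log m)) / (2 * (c ^ 2 * m)) = -(2 * Real.log m) := by
      field_simp
    rw [this, Real.exp_neg, two_mul, Real.exp_add, Real.exp_log (by linarith), one_div, sq]
  have hsum : Summable fun L : ℕ => 2 * (1 / ((L + (N + 1) : ℕ) : ℝ) ^ 2) :=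
    ((summable_nat_add_iff (f := fun L : ℕ => 1 / (L : ℝ) ^ 2) (N + 1)).2
      (Real.summable_one_div_nat_pow.2 one_lt_two)).mul_left 2
  have hfin : ∑' L : ℕ, μ {ω | 2 * c * √(((L + (N + 1) : ℕ) : ℝ) * Real.log (L + (N + 1) : ℕ))
      ≤ |X (L + (N + 1)) ω|} ≠ ∞ :=
    ne_top_of_le_ne_top hsum.tsum_ofReal_ne_top (ENNReal.tsum_le_tsum hbound)
  filter_upwards [ae_eventually_notMem hfin] with ω hω
  obtain ⟨N', hN'⟩ := eventually_atTop.1 hω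
  filter_upwards [eventually_ge_atTop (N' + (N + 1))] with L hL
  have := hN' (L - (N + 1)) (by omega)
  rw [Nat.sub_add_cancel (by omega)] at this
  exact (not_le.1 this).le

theorem tendsto_log_div_sqrt : Tendsto (fun L : ℕ => Real.log L / √(L : ℝ)) atTop (𝓝 0) := by
  have h := (isLittleO_log_rpow_atTop (r := 1 / 2) (by norm_num)).tendsto_div_nhds_zero
  refine (h.comp tendsto_natCast_atTop_atTop).congr fun L => ?_
  simp [Real.sqrt_eq_rpow]

/-- Replacing the variance proxy by another one at relative distance `√(log L / L)` does not
matter for standardized quantities of order `√(log L)`. -/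
theorem tendsto_div_sqrt_sub_div_sqrt {x V v : ℕ → ℝ} {K c : ℝ} (hK : 0 ≤ K) (hc : 0 < c)
    (hx : ∀ᶠ L : ℕ in atTop, |x L| ≤ K * √(L * Real.log L))
    (hV : ∀ᶠ L : ℕ in atTop, |V L - v L| ≤ K * √(L * Real.log L))
    (hv : ∀ᶠ L : ℕ in atTop, c * L ≤ v L) :
    Tendsto (fun L => x L / √(V L) - x L / √(v L)) atTop (𝓝 0) := by
  have hlim : Tendsto (fun L : ℕ => K ^ 2 / (c / 2 * √(c / 2)) * (Real.log L / √(L : ℝ)))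
      atTop (𝓝 0) := by simpa using tendsto_log_div_sqrt.const_mul (K ^ 2 / (c / 2 * √(c / 2)))
  -- This transfers the lower bound from `v` to `V`, with half the constant.
  have hsmall : ∀ᶠ L : ℕ in atTop, K * √(L * Real.log L) ≤ c / 2 * L := by
    have h := tendsto_log_div_sqrt.const_mul (K ^ 2)
    rw [mul_zero] at h
    filter_upwards [h.eventually_le_const (show 0 < (c / 2) ^ 2 by positivity),
      eventually_ge_atTop 1] with L hL h1
    have hL1 : (1 : ℝ) ≤ L := by exact_mod_cast h1
    have hs : 1 ≤ √(L : ℝ) := Real.one_le_sqrt.2 hL1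
    have hlog : 0 ≤ Real.log L := Real.log_nonneg hL1
    refine abs_le_of_sq_le_sq' ?_ (by positivity) |>.2
    rw [mul_pow, mul_pow, Real.sq_sqrt (by positivity)]
    rw [← mul_div_assoc, div_le_iff₀ (by linarith)] at hL
    have : √(L : ℝ) ≤ L := by
      nlinarith [Real.sq_sqrt (show (0 : ℝ) ≤ L by linarith)]
    calc K ^ 2 * (L * Real.log L) = L * (K ^ 2 * Real.log L) := by ring
      _ ≤ L * ((c / 2) ^ 2 * √(L : ℝ)) := mul_le_mul_of_nonneg_left hL (by linarith)
      _ ≤ L * ((c / 2) ^ 2 * L) := by gcongr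
      _ = _ := by ring
  refine squeeze_zero_norm' ?_ hlim
  filter_upwards [hx, hV, hv, hsmall, eventually_ge_atTop 1] with L hx hV hv hs h1
  have hL1 : (1 : ℝ) ≤ L := by exact_mod_cast h1
  have hlog : 0 ≤ Real.log L := Real.log_nonneg hL1
  set w := c / 2 * (L : ℝ) with hw
  have hwpos : 0 < w := by positivity
  have hVw : w ≤ V L := by
    have := (abs_le.1 hV).1
    have : c * (L : ℝ) = 2 * w := by rw [hw]; ring
    linarith
  have hvw : w ≤ v L := by
    have : c * (L : ℝ) = 2 * w := by rw [hw]; ring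
    linarith
  have hsV : √w ≤ √(V L) := Real.sqrt_le_sqrt hVw
  have hsv : √w ≤ √(v L) := Real.sqrt_le_sqrt hvw
  have hsw : 0 < √w := Real.sqrt_pos.2 hwpos
  have hVV := Real.sq_sqrt (hwpos.le.trans hVw)
  have hvv := Real.sq_sqrt (hwpos.le.trans hvw)
  have hww := Real.sq_sqrt hwpos.le
  set p := √(V L)
  set q := √(v L)
  have hp : 0 < p := hsw.trans_le hsV
  have hq : 0 < q := hsw.trans_le hsv
  have e : x L / p - x L / q = x L * (v L - V L) / (p * q * (p + q)) := by
    rw [← hVV, ← hvv]; field_simp; ring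
  have hden : w * √w ≤ p * q * (p + q) := by
    calc w * √w = √w * √w * √w := by rw [← sq (√w), hww]
      _ ≤ p * q * (p + q) := by
        gcongr
        linarith
  rw [Real.norm_eq_abs, e, abs_div, abs_mul, abs_of_pos (show 0 < p * q * (p + q) by positivity),
    abs_sub_comm (v L)]
  calc |x L| * |V L - v L| / (p * q * (p + q))
      ≤ (K * √(L * Real.log L)) * (K * √(L * Real.log L)) / (w * √w) := by
        gcongr
    _ = K ^ 2 * (L * Real.log L) / (w * √w) := by
        congr 1
        rw [mul_mul_mul_comm, Real.mul_self_sqrt (by positivity)]; ring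
    _ = _ := by
        have : 0 < √(L : ℝ) := Real.sqrt_pos.2 (by linarith)
        rw [hw, Real.sqrt_mul (by positivity)]
        field_simp

end Sequences

/-! ### Conditioning a permuted statistic on the observations -/

section UniformPermutation

variable {Ω E : Type*} [mΩ : MeasurableSpace Ω] [MeasurableSpace E] {μ : Measure Ω}
  [IsProbabilityMeasure μ] {Y : ℕ → Ω → E} {n L : ℕ} {P : Ω → Equiv.Perm (window n L)}

-- Splitting over the finitely many values of `P` separates an observation-measurable factor from an
-- indicator independent of the observations.
omit mΩ [MeasurableSpace E] in
theorem IsUniformPerm.eq_sum (h : (ℕ → E) → Equiv.Perm (window n L) → ℝ) :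
    (fun ω => h (fun i => Y i ω) (P ω)) = ∑ σ : Equiv.Perm (window n L),
      (fun ω => h (fun i => Y i ω) σ) * (P ⁻¹' {σ}).indicator fun _ => (1 : ℝ) := by
  classical
  funext ω
  rw [Finset.sum_apply, Finset.sum_eq_single (P ω)]
  · simp
  · intro σ _ hσ
    simp [hσ.symm]
  · simp

omit [IsProbabilityMeasure μ] in
theorem IsUniformPerm.measurable_comp (hP : IsUniformPerm μ Y P)
    (hY : Measurable fun ω i => Y i ω) {h : (ℕ → E) → Equiv.Perm (window n L) → ℝ}
    (hm : ∀ σ, Measurable fun y => h y σ) :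
    Measurable fun ω => h (fun i => Y i ω) (P ω) := by
  rw [IsUniformPerm.eq_sum]
  convert Finset.measurable_sum Finset.univ fun (σ : Equiv.Perm (window n L)) _ =>
    ((hm σ).comp hY).mul (measurable_const (a := (1 : ℝ)).indicator (hP.measurable σ)) using 1
  funext ω
  simp

/-- Conditioning on the observations averages over the permutation. -/
theorem IsUniformPerm.condExp_eq (hP : IsUniformPerm μ Y P) (hY : Measurable fun ω i => Y i ω)
    {h : (ℕ → E) → Equiv.Perm (window n L) → ℝ} (hm : ∀ σ, Measurable fun y => h y σ) {B : ℝ}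
    (hB : ∀ y σ, |h y σ| ≤ B) :
    μ[fun ω => h (fun i => Y i ω) (P ω) |
      MeasurableSpace.comap (fun ω' i => Y i ω') MeasurableSpace.pi]
      =ᵐ[μ] fun ω => favg (h fun i => Y i ω) := by
  have hind : ∀ σ, Integrable ((P ⁻¹' {σ}).indicator fun _ => (1 : ℝ)) μ := fun σ =>
    (integrable_const 1).indicator (hP.measurable σ)
  have hprod : ∀ σ, Integrable ((fun ω => h (fun i => Y i ω) σ) *
      (P ⁻¹' {σ}).indicator fun _ => (1 : ℝ)) μ := fun σ =>
    (hind σ).bdd_mul ((hm σ).comp hY).aestronglyMeasurable (ae_of_all _ fun ω => hB _ σ)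
  have hval : ∀ σ, ∫ ω, (P ⁻¹' {σ}).indicator (fun _ => (1 : ℝ)) ω ∂μ
      = (Fintype.card (Equiv.Perm (window n L)) : ℝ)⁻¹ := fun σ => by
    rw [integral_indicator_const _ (hP.measurable σ), measureReal_def, hP.uniform σ]
    simp
  have hleP : MeasurableSpace.comap P ⊤ ≤ mΩ := by
    rintro s ⟨t, -, rfl⟩
    rw [← Set.biUnion_preimage_singleton]
    exact MeasurableSet.biUnion (Set.to_countable t) fun σ _ => hP.measurable σ
  have hindep := hP.indep
  set m := MeasurableSpace.comap (fun ω' i => Y i ω') MeasurableSpace.pi with hmdef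
  have hle : m ≤ mΩ := hY.comap_le
  have hsm : ∀ σ, StronglyMeasurable[m] fun ω => h (fun i => Y i ω) σ := fun σ =>
    ((hm σ).comp (comap_measurable _)).stronglyMeasurable
  have hterm : ∀ σ, μ[(fun ω => h (fun i => Y i ω) σ) *
      (P ⁻¹' {σ}).indicator fun _ => (1 : ℝ) | m] =ᵐ[μ]
        fun ω => h (fun i => Y i ω) σ * (Fintype.card (Equiv.Perm (window n L)) : ℝ)⁻¹ := fun σ => by
    refine (condExp_mul_of_stronglyMeasurable_left (hsm σ) (hprod σ) (hind σ)).trans ?_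
    have h2 := condExp_indep_eq (μ := μ) hleP hle (f := (P ⁻¹' {σ}).indicator fun _ => (1 : ℝ))
      ((stronglyMeasurable_const.indicator ⟨{σ}, trivial, rfl⟩)) hindep
    filter_upwards [h2] with ω hω
    rw [Pi.mul_apply, hω, hval]
  rw [IsUniformPerm.eq_sum]
  refine (condExp_finsetSum (fun σ _ => hprod σ) m).trans ?_
  filter_upwards [ae_all_iff.2 hterm] with ω hω
  rw [Finset.sum_apply, Finset.sum_congr rfl fun σ _ => hω σ, ← Finset.sum_mul, favg, mul_comm]

theorem IsUniformPerm.integral_eq (hP : IsUniformPerm μ Y P) (hY : Measurable fun ω i => Y i ω)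
    {h : (ℕ → E) → Equiv.Perm (window n L) → ℝ} (hm : ∀ σ, Measurable fun y => h y σ) {B : ℝ}
    (hB : ∀ y σ, |h y σ| ≤ B) :
    ∫ ω, h (fun i => Y i ω) (P ω) ∂μ = ∫ ω, favg (h fun i => Y i ω) ∂μ := by
  rw [← integral_condExp (μ := μ) (hY.comap_le), integral_congr_ae (hP.condExp_eq hY hm hB)]

variable {ρ : (ℕ → E) → Equiv.Perm (window n L) → ℝ} {M : ℝ}

theorem IsUniformPerm.integral_eq_of_favg (hP : IsUniformPerm μ Y P)
    (hY : Measurable fun ω i => Y i ω) (hm : ∀ σ, Measurable fun y => ρ y σ) {B : ℝ}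
    (hB : ∀ y σ, |ρ y σ| ≤ B) (hM : ∀ᵐ ω ∂μ, favg (ρ fun i => Y i ω) = M) :
    ∫ ω, ρ (fun i => Y i ω) (P ω) ∂μ = M := by
  rw [hP.integral_eq hY hm hB, integral_congr_ae hM]
  simp

/-- The conditional mean is the constant `M`, so centring commutes with averaging over the
permutation. -/
theorem IsUniformPerm.condVar_eq (hP : IsUniformPerm μ Y P) (hY : Measurable fun ω i => Y i ω)
    (hm : ∀ σ, Measurable fun y => ρ y σ) {B : ℝ} (hB : ∀ y σ, |ρ y σ| ≤ B)
    (hM : ∀ᵐ ω ∂μ, favg (ρ fun i => Y i ω) = M) :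
    condVar (MeasurableSpace.comap (fun ω' i => Y i ω') MeasurableSpace.pi)
      (fun ω => ρ (fun i => Y i ω) (P ω)) μ
      =ᵐ[μ] fun ω => favg fun σ => (ρ (fun i => Y i ω) σ - M) ^ 2 := by
  have h1 := hP.condExp_eq hY hm hB
  rw [condVar]
  refine EventuallyEq.trans (condExp_congr_ae ?_)
    (hP.condExp_eq hY (h := fun y σ => (ρ y σ - M) ^ 2) (fun σ => ((hm σ).sub_const M).pow_const 2)
      (B := (B + |M|) ^ 2) fun y σ => ?_)
  · filter_upwards [h1, hM] with ω h1 h2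
    rw [Pi.pow_apply, Pi.sub_apply, h1, h2]
  · rw [abs_pow]
    exact pow_le_pow_left₀ (abs_nonneg _) ((abs_sub _ _).trans (add_le_add_left (hB _ _) _)) 2

/-- In the law of total variance the variance of the conditional mean vanishes. -/
theorem IsUniformPerm.variance_eq (hP : IsUniformPerm μ Y P) (hY : Measurable fun ω i => Y i ω)
    (hm : ∀ σ, Measurable fun y => ρ y σ) {B : ℝ} (hB : ∀ y σ, |ρ y σ| ≤ B)
    (hM : ∀ᵐ ω ∂μ, favg (ρ fun i => Y i ω) = M) :
    variance (fun ω => ρ (fun i => Y i ω) (P ω)) μ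
      = ∫ ω, favg (fun σ => (ρ (fun i => Y i ω) σ - M) ^ 2) ∂μ := by
  rw [variance_eq_integral (hP.measurable_comp hY hm).aemeasurable,
    hP.integral_eq_of_favg hY hm hB hM]
  refine hP.integral_eq hY (h := fun y σ => (ρ y σ - M) ^ 2)
    (fun σ => ((hm σ).sub_const M).pow_const 2) (B := (B + |M|) ^ 2) fun y σ => ?_
  rw [abs_pow]
  exact pow_le_pow_left₀ (abs_nonneg _) ((abs_sub _ _).trans (add_le_add_left (hB _ _) _)) 2

/-- The permutation tail bound holds for almost every fixed sequence of observations with the same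
right-hand side, and is then integrated. -/
theorem IsUniformPerm.measureReal_abs_sub_ge_le (hP : IsUniformPerm μ Y P)
    (hY : Measurable fun ω i => Y i ω) (hm : ∀ σ, Measurable fun y => ρ y σ)
    (hM : ∀ᵐ ω ∂μ, favg (ρ fun i => Y i ω) = M) {c : ℝ} (hc : 0 < c) (hL : 0 < L) (hLn : L ≤ n)
    (hlip : ∀ᵐ ω ∂μ, ∀ u v σ, |ρ (fun i => Y i ω) (σ * Equiv.swap u v) - ρ (fun i => Y i ω) σ| ≤ c)
    {r : ℝ} (hr : 0 ≤ r) :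
    μ.real {ω | r ≤ |ρ (fun i => Y i ω) (P ω) - M|}
      ≤ 2 * Real.exp (-r ^ 2 / (2 * (c ^ 2 * L))) := by
  have hcard : Fintype.card (window n L) = L := by
    rw [Fintype.card_coe, Nat.card_Ioc]; omega
  have : Nonempty (window n L) := Fintype.card_pos_iff.1 (by omega)
  set h : (ℕ → E) → Equiv.Perm (window n L) → ℝ := fun y σ => if r ≤ |ρ y σ - M| then 1 else 0
    with hh
  have hhm : ∀ σ, Measurable fun y => h y σ := fun σ =>
    Measurable.ite (measurableSet_le measurable_const
      (continuous_abs.measurable.comp ((hm σ).sub_const M))) measurable_const measurable_const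
  have hhB : ∀ y σ, |h y σ| ≤ 1 := fun y σ => by
    simp only [hh]; split_ifs <;> simp
  have hset : MeasurableSet {ω | r ≤ |ρ (fun i => Y i ω) (P ω) - M|} :=
    measurableSet_le measurable_const
      (continuous_abs.measurable.comp ((hP.measurable_comp hY hm).sub_const M))
  have e : μ.real {ω | r ≤ |ρ (fun i => Y i ω) (P ω) - M|}
      = ∫ ω, h (fun i => Y i ω) (P ω) ∂μ := by
    rw [← integral_indicator_one hset]
    congr 1
  rw [e, hP.integral_eq hY hhm hhB]
  refine (le_abs_self _).trans (abs_integral_le_of_bound ?_)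
  filter_upwards [hM, hlip] with ω h1 h2
  rw [abs_of_nonneg (favg_nonneg fun σ => by simp only [hh]; split_ifs <;> norm_num)]
  have := favg_perm_indicator_le (window n L) hc (ρ fun i => Y i ω) h2 hr
  rwa [h1, hcard] at this

end UniformPermutation

/-! ### Transfer to the i.i.d. sequence and concentration of graph statistics -/

section IID

variable {Ω E : Type*} [MeasurableSpace Ω] [MetricSpace E] [MeasurableSpace E] {μ : Measure Ω}
  [IsProbabilityMeasure μ] {Y : ℕ → Ω → E} {ν : Measure E} [IsProbabilityMeasure ν]

theorem card_window {n L : ℕ} (h : L ≤ n) : (window n L).card = L := by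
  rw [Nat.card_Ioc]; omega

omit [MetricSpace E] in
theorem map_eq_infinitePi_of_iid (hYmeas : ∀ i, Measurable (Y i)) (hYindep : iIndepFun Y μ)
    (hYident : ∀ i, IdentDistrib (Y i) (Y 1) μ μ) :
    μ.map (fun ω i => Y i ω) = Measure.infinitePi fun _ : ℕ => μ.map (Y 1) := by
  have : ∀ i, IsProbabilityMeasure (μ.map (Y i)) := fun i =>
    Measure.isProbabilityMeasure_map (hYmeas i).aemeasurable
  rw [hYindep.map_fun_eq_infinitePi_map hYmeas]
  congr 1
  funext i
  exact (hYident i).map_eq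

theorem measurable_dist_eval (hdist : Measurable fun p : E × E => dist p.1 p.2) (a b : ℕ) :
    Measurable fun y : ℕ → E => dist (y a) (y b) :=
  hdist.comp ((measurable_pi_apply (X := fun _ : ℕ => E) a).prodMk (measurable_pi_apply b))

theorem measurableSet_noTies (hdist : Measurable fun p : E × E => dist p.1 p.2) :
    MeasurableSet {y : ℕ → E | NoTies y} := by
  have : {y : ℕ → E | NoTies y} = ⋂ (i) (j) (l) (_ : i ≠ j) (_ : i ≠ l) (_ : j ≠ l),
      {y | dist (y i) (y j) = dist (y i) (y l)}ᶜ := by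
    ext y; simp [NoTies]
  rw [this]
  refine MeasurableSet.iInter fun i => MeasurableSet.iInter fun j => MeasurableSet.iInter fun l =>
    MeasurableSet.iInter fun _ => MeasurableSet.iInter fun _ => MeasurableSet.iInter fun _ => ?_
  exact (measurableSet_eq_fun (measurable_dist_eval hdist i j)
    (measurable_dist_eval hdist i l)).compl

theorem measurableSet_inDegLE (hdist : Measurable fun p : E × E => dist p.1 p.2) (S : Finset ℕ)
    (k : ℕ) (C : ℝ) : MeasurableSet {y : ℕ → E | InDegLE S k C y} := by
  have : {y : ℕ → E | InDegLE S k C y} = ⋂ j ∈ S, {y | ∑ i ∈ S, knnInd S y k i j ≤ C} := by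
    ext y; simp [InDegLE]
  rw [this]
  exact Finset.measurableSet_biInter _ fun j _ => measurableSet_le
    (Finset.measurable_sum _ fun i _ => measurable_knnInd hdist S k i j) measurable_const

-- Bounded in-degrees are assumed only for initial segments; the i.i.d. law is shift invariant, so
-- the bound for `1, …, L` carries over to every window of length `L`.
omit [IsProbabilityMeasure μ] in
theorem ae_inDegLE_window (hdist : Measurable fun p : E × E => dist p.1 p.2)
    (hY : Measurable fun ω i => Y i ω)
    (hlaw : μ.map (fun ω i => Y i ω) = Measure.infinitePi fun _ : ℕ => ν) {k : ℕ} {C : ℝ}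
    {n L : ℕ} (hdeg : ∀ᵐ ω ∂μ, InDegLE (Finset.Icc 1 L) k C fun m => Y m ω) (hn : L ≤ n) :
    ∀ᵐ ω ∂μ, InDegLE (window n L) k C fun m => Y m ω := by
  set e : ℕ ↪ ℕ := addRightEmbedding (n - L) with he
  have hmap : (Finset.Icc 1 L).map e = window n L := by
    rw [he, Finset.map_add_right_Icc]
    ext x
    simp only [Finset.mem_Icc, Finset.mem_Ioc]
    omega
  have h1 : ∀ᵐ y ∂(Measure.infinitePi fun _ : ℕ => ν), InDegLE (Finset.Icc 1 L) k C y := by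
    rw [← hlaw, ae_map_iff hY.aemeasurable (measurableSet_inDegLE hdist _ k C)]
    exact hdeg
  have hm : Measurable fun (y : ℕ → E) i => y (e i) :=
    measurable_pi_iff.2 fun i => measurable_pi_apply _
  have h2 : ∀ᵐ y ∂(Measure.infinitePi fun _ : ℕ => ν),
      InDegLE (Finset.Icc 1 L) k C fun m => y (e m) := by
    rw [← Measure.map_infinitePi_infinitePi_of_inj (P := fun _ : ℕ => ν) e.injective,
      ae_map_iff hm.aemeasurable (measurableSet_inDegLE hdist _ k C)] at h1
    exact h1
  rw [← hlaw, ae_map_iff (p := fun y => InDegLE (Finset.Icc 1 L) k C fun m => y (e m))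
    hY.aemeasurable (hm (measurableSet_inDegLE hdist (Finset.Icc 1 L) k C))] at h2
  filter_upwards [h2] with ω hω
  rw [← hmap]
  exact inDegLE_map hω

omit [IsProbabilityMeasure μ] in
/-- Concentration of a statistic of the nearest neighbour graph that is stable under removing
one observation. -/
theorem measureReal_abs_sub_integral_ge_le (hdist : Measurable fun p : E × E => dist p.1 p.2)
    (hY : Measurable fun ω i => Y i ω)
    (hlaw : μ.map (fun ω i => Y i ω) = Measure.infinitePi fun _ : ℕ => ν)
    (hties : ∀ᵐ ω ∂μ, NoTies fun m => Y m ω) {k : ℕ} {C : ℝ} {n L : ℕ}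
    (hdeg : ∀ᵐ ω ∂μ, InDegLE (window n L) k C fun m => Y m ω) (hL : 0 < L) (hn : L ≤ n)
    {f : Finset ℕ → (ℕ → E) → ℝ} (hf : ∀ S, Measurable (f S)) (hB : ∀ S, ∃ B, ∀ y, |f S y| ≤ B)
    (hcongr : ∀ S y y', (∀ i ∈ S, y i = y' i) → f S y = f S y') {c : ℝ} (hc : 0 < c)
    (herase : ∀ y, NoTies y → InDegLE (window n L) k C y → ∀ i ∈ window n L,
      |f (window n L) y - f ((window n L).erase i) y| ≤ c) {r : ℝ} (hr : 0 ≤ r) :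
    μ.real {ω | r ≤ |f (window n L) (fun m => Y m ω)
        - ∫ ω', f (window n L) (fun m => Y m ω') ∂μ|}
      ≤ 2 * Real.exp (-r ^ 2 / (2 * (c ^ 2 * L))) := by
  set S := window n L with hS
  have hcard : S.card = L := card_window hn
  have hg : ∀ᵐ y ∂(Measure.infinitePi fun _ : ℕ => ν), NoTies y ∧ InDegLE S k C y := by
    rw [← hlaw, ae_map_iff (p := fun y => NoTies y ∧ InDegLE S k C y) hY.aemeasurable
      ((measurableSet_noTies hdist).inter (measurableSet_inDegLE hdist S k C))]
    exact hties.and hdeg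
  -- The statistic of the graph without `i` is the approximant that ignores coordinate `i`.
  have key := measure_abs_sub_integral_ge_le ν hc (S := S) (Finset.card_pos.1 (by omega)) (hf S)
    (hB S) (hcongr S) (fun i hi => ⟨f (S.erase i), hf _, hB _, fun y x => hcongr _ _ _ fun j hj =>
      Function.update_of_ne (Finset.ne_of_mem_erase hj) _ _, by
        filter_upwards [hg] with y hy using herase y hy.1 hy.2 i hi⟩) hr
  rw [← hlaw, integral_map hY.aemeasurable (hf S).aestronglyMeasurable, hcard] at key
  have hmeas : MeasurableSet {y | r ≤ |f S y - ∫ ω', f S (fun m => Y m ω') ∂μ|} :=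
    measurableSet_le measurable_const (continuous_abs.measurable.comp ((hf S).sub_const _))
  rw [map_measureReal_apply hY hmeas] at key
  exact key

theorem ae_eventually_abs_sub_integral_le (hdist : Measurable fun p : E × E => dist p.1 p.2)
    (hY : Measurable fun ω i => Y i ω)
    (hlaw : μ.map (fun ω i => Y i ω) = Measure.infinitePi fun _ : ℕ => ν)
    (hties : ∀ᵐ ω ∂μ, NoTies fun m => Y m ω) {k : ℕ} {C : ℝ} {n : ℕ → ℕ}
    (hdeg : ∀ L, ∀ᵐ ω ∂μ, InDegLE (window (n L) L) k C fun m => Y m ω) (hn : ∀ L, L ≤ n L)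
    {f : Finset ℕ → (ℕ → E) → ℝ} (hf : ∀ S, Measurable (f S)) (hB : ∀ S, ∃ B, ∀ y, |f S y| ≤ B)
    (hcongr : ∀ S y y', (∀ i ∈ S, y i = y' i) → f S y = f S y') {c : ℝ} (hc : 0 < c)
    (herase : ∀ S y, NoTies y → InDegLE S k C y → ∀ i ∈ S, |f S y - f (S.erase i) y| ≤ c) :
    ∀ᵐ ω ∂μ, ∀ᶠ L : ℕ in atTop, |f (window (n L) L) (fun m => Y m ω)
        - ∫ ω', f (window (n L) L) (fun m => Y m ω') ∂μ| ≤ 2 * c * √(L * Real.log L) := by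
  refine ae_eventually_abs_le_sqrt_mul_log hc ?_
  filter_upwards [eventually_gt_atTop 0] with L hL r hr
  exact measureReal_abs_sub_integral_ge_le hdist hY hlaw hties (hdeg L) hL (hn L) hf hB hcongr hc
    (fun y => herase _ y) hr

end IID

/-! ### Mean, variance and tails of quadratic forms over the graph -/

section QuadraticForm

variable {Ω E : Type*} [MeasurableSpace Ω] [MetricSpace E] [MeasurableSpace E] {μ : Measure Ω}
  [IsProbabilityMeasure μ] {Y : ℕ → Ω → E}

/-- The statistic `∑ A⁺ i j * Φ (σ i) (σ j)` of the nearest neighbour graph on a window. -/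
noncomputable def graphForm (k : ℕ) {n L : ℕ} (Φ : window n L → window n L → ℝ) (y : ℕ → E)
    (σ : Equiv.Perm (window n L)) : ℝ :=
  ∑ i : window n L, ∑ j : window n L, knnInd (window n L) y k i j * Φ (σ i) (σ j)

variable {k n L : ℕ} {Φ : window n L → window n L → ℝ} {b C : ℝ}

theorem measurable_graphForm (hdist : Measurable fun p : E × E => dist p.1 p.2)
    (σ : Equiv.Perm (window n L)) : Measurable fun y : ℕ → E => graphForm k Φ y σ :=
  Finset.measurable_sum _ fun i _ => Finset.measurable_sum _ fun j _ =>
    (measurable_knnInd hdist _ k i j).mul_const _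

omit [MeasurableSpace E] in
theorem abs_graphForm_le (hn : L ≤ n) (hb : ∀ i j, |Φ i j| ≤ b) (y : ℕ → E)
    (σ : Equiv.Perm (window n L)) : |graphForm k Φ y σ| ≤ L * (L * b) := by
  have hcard : (Finset.univ : Finset (window n L)).card = L := by
    rw [Finset.card_univ, Fintype.card_coe, card_window hn]
  have h1 : ∀ i j : window n L, |knnInd (window n L) y k i j * Φ (σ i) (σ j)| ≤ b := fun i j => by
    rw [abs_mul, abs_of_nonneg (knnInd_nonneg _ _ _ _ _)]
    exact (mul_le_of_le_one_left (abs_nonneg _) (knnInd_le_one _ _ _ _ _)).trans (hb _ _)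
  have h2 : ∀ i : window n L, |∑ j : window n L, knnInd (window n L) y k i j * Φ (σ i) (σ j)|
      ≤ L * b := fun i => by
    refine (Finset.abs_sum_le_sum_abs _ _).trans ((Finset.sum_le_card_nsmul _ _ b
      fun j _ => h1 i j).trans_eq ?_)
    rw [hcard, nsmul_eq_mul]
  refine (Finset.abs_sum_le_sum_abs _ _).trans ((Finset.sum_le_card_nsmul _ _ _
    fun i _ => h2 i).trans_eq ?_)
  rw [hcard, nsmul_eq_mul]

/-- Fluctuations of a quadratic form in a random permutation over the nearest neighbour graph. -/
theorem graphForm_moments (hdist : Measurable fun p : E × E => dist p.1 p.2)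
    (hY : Measurable fun ω i => Y i ω) (hties : ∀ᵐ ω ∂μ, NoTies fun m => Y m ω)
    (hdeg : ∀ᵐ ω ∂μ, InDegLE (window n L) k C fun m => Y m ω) (hL : 4 ≤ L) (hkL : k < L)
    (hn : L ≤ n) {P : Ω → Equiv.Perm (window n L)} (hP : IsUniformPerm μ Y P)
    (hC : 1 ≤ C) (hb0 : 0 < b) (hb : ∀ i j, |Φ i j| ≤ b) {a c₀ c₁ c₂ : ℝ} (ha : |a| ≤ b)
    (H : PairMoments (fun i j => Φ i j - a) c₀ c₁ c₂) :
    (∀ᵐ ω ∂μ, |condVar (MeasurableSpace.comap (fun ω' i => Y i ω') MeasurableSpace.pi)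
          (fun ω => graphForm k Φ (fun i => Y i ω) (P ω)) μ ω
        - variance (fun ω => graphForm k Φ (fun i => Y i ω) (P ω)) μ|
      ≤ 16 * b ^ 2 * (|mutualCount (window n L) k (fun i => Y i ω)
            - ∫ ω', mutualCount (window n L) k (fun i => Y i ω') ∂μ|
          + |inDegSq (window n L) k (fun i => Y i ω)
            - ∫ ω', inDegSq (window n L) k (fun i => Y i ω') ∂μ|)) ∧
    variance (fun ω => graphForm k Φ (fun i => Y i ω) (P ω)) μ
      = (c₂ - 2 * c₁ + c₀) * (k * L + ∫ ω', mutualCount (window n L) k (fun i => Y i ω') ∂μ)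
        + (c₁ - c₀) * (3 * k ^ 2 * L + ∫ ω', inDegSq (window n L) k (fun i => Y i ω') ∂μ)
        + c₀ * (k ^ 2 * L ^ 2) ∧
    ∀ r : ℝ, 0 ≤ r → μ.real {ω | r ≤ |graphForm k Φ (fun i => Y i ω) (P ω)
        - ∫ ω', graphForm k Φ (fun i => Y i ω') (P ω') ∂μ|}
      ≤ 2 * Real.exp (-r ^ 2 / (2 * ((4 * b * (k + C)) ^ 2 * L))) := by
  have hcard : Fintype.card (window n L) = L := by rw [Fintype.card_coe, card_window hn]
  have hrow : ∀ y : ℕ → E, NoTies y → ∀ i : window n L, ∑ j : window n L, knnInd (window n L) y k i j = k := fun y hy i => by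
    rw [Finset.sum_coe_sort (window n L) fun j => knnInd (window n L) y k i j]
    exact sum_knnInd_eq hy i.2 (by rw [card_window hn]; exact hkL)
  -- There are exactly `k L` edges, so centring the kernel by `a` shifts the form by a constant.
  have hsub : ∀ y : ℕ → E, NoTies y → ∀ σ, graphForm k Φ y σ - a * (k * L)
      = ∑ i : window n L, ∑ j : window n L, knnInd (window n L) y k i j * (Φ (σ i) (σ j) - a) := fun y hy σ => by
    simp_rw [mul_sub, Finset.sum_sub_distrib, ← Finset.sum_mul, hrow y hy]
    rw [Finset.sum_const, nsmul_eq_mul, Finset.card_univ, hcard, graphForm]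
    ring
  have hmean : ∀ y : ℕ → E, NoTies y → favg (graphForm k Φ y) = a * (k * L) := fun y hy => by
    have h1 := H.favg_sum_eq_zero (A := fun i j : (window n L) => knnInd (window n L) y k i j) fun i => knnInd_self _ _ _ _
    simp_rw [← hsub y hy] at h1
    rw [favg_sub, favg_const] at h1
    linarith
  have hvar : ∀ y : ℕ → E, NoTies y → favg (fun σ => (graphForm k Φ y σ - a * (k * L)) ^ 2)
      = (c₂ - 2 * c₁ + c₀) * (k * L + mutualCount (window n L) k y)
        + (c₁ - c₀) * (3 * k ^ 2 * L + inDegSq (window n L) k y) + c₀ * (k ^ 2 * L ^ 2) := fun y hy => by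
    simp_rw [hsub y hy]
    rw [H.favg_sum_sq (A := fun i j : (window n L) => knnInd (window n L) y k i j) (fun i => knnInd_self _ _ _ _)
      (hrow y hy) (fun i j => knnInd_mul_self _ _ _ _ _), hcard]
    congr 3
    · congr 1
      rw [mutualCount, ← Finset.sum_coe_sort (window n L)]
      refine Finset.sum_congr rfl fun i _ => ?_
      rw [← Finset.sum_coe_sort (window n L)]
    · congr 1
      rw [inDegSq, ← Finset.sum_coe_sort (window n L)]
      refine Finset.sum_congr rfl fun j _ => ?_
      rw [← Finset.sum_coe_sort (window n L)]
  have hm : ∀ σ, Measurable fun y : ℕ → E => graphForm k Φ y σ := measurable_graphForm hdist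
  have hB : ∀ (y : ℕ → E) σ, |graphForm k Φ y σ| ≤ L * (L * b) := abs_graphForm_le hn hb
  have hM : ∀ᵐ ω ∂μ, favg (graphForm k Φ fun i => Y i ω) = a * (k * L) := by
    filter_upwards [hties] with ω hω using hmean _ hω
  have hmI : Integrable (fun ω => mutualCount (window n L) k fun i => Y i ω) μ :=
    integrable_of_measurable_of_bound ((measurable_mutualCount hdist (window n L) k).comp hY)
      fun ω => abs_mutualCount_le _ _ _
  have hdI : Integrable (fun ω => inDegSq (window n L) k fun i => Y i ω) μ :=
    integrable_of_measurable_of_bound ((measurable_inDegSq hdist (window n L) k).comp hY)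
      fun ω => abs_inDegSq_le _ _ _
  have hV : variance (fun ω => graphForm k Φ (fun i => Y i ω) (P ω)) μ
      = (c₂ - 2 * c₁ + c₀) * (k * L + ∫ ω', mutualCount (window n L) k (fun i => Y i ω') ∂μ)
        + (c₁ - c₀) * (3 * k ^ 2 * L + ∫ ω', inDegSq (window n L) k (fun i => Y i ω') ∂μ)
        + c₀ * (k ^ 2 * L ^ 2) := by
    rw [hP.variance_eq hY hm hB hM]
    have : ∀ᵐ ω ∂μ, favg (fun σ => (graphForm k Φ (fun i => Y i ω) σ - a * (k * L)) ^ 2)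
        = (c₂ - 2 * c₁ + c₀) * (k * L + mutualCount (window n L) k fun i => Y i ω)
          + (c₁ - c₀) * (3 * k ^ 2 * L + inDegSq (window n L) k fun i => Y i ω) + c₀ * (k ^ 2 * L ^ 2) := by
      filter_upwards [hties] with ω hω using hvar _ hω
    have i1 : Integrable (fun ω => (c₂ - 2 * c₁ + c₀) * (k * L + mutualCount (window n L) k fun i => Y i ω)) μ :=
      ((integrable_const _).add hmI).const_mul _
    have i2 : Integrable (fun ω => (c₁ - c₀) * (3 * k ^ 2 * L + inDegSq (window n L) k fun i => Y i ω)) μ :=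
      ((integrable_const _).add hdI).const_mul _
    have i12 : Integrable (fun ω => (c₂ - 2 * c₁ + c₀)
          * (k * L + mutualCount (window n L) k fun i => Y i ω)
        + (c₁ - c₀) * (3 * k ^ 2 * L + inDegSq (window n L) k fun i => Y i ω)) μ := i1.add i2
    rw [integral_congr_ae this, integral_add i12 (integrable_const _), integral_add i1 i2,
      integral_const_mul, integral_const_mul, integral_add (integrable_const _) hmI,
      integral_add (integrable_const _) hdI]
    simp
  refine ⟨?_, hV, fun r hr => ?_⟩
  -- The centred kernel is bounded by `2 b`, so each moment is at most `4 b²`; `c₂ - 2 c₁ + c₀` has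
  -- total weight four, whence `16 b²`.
  · have habs := H.abs_le (by rw [hcard]; exact hL) (B := 2 * b) fun i j =>
      (abs_sub _ _).trans ((add_le_add (hb i j) ha).trans_eq (two_mul b).symm)
    obtain ⟨h0, h1, h2⟩ := habs
    rw [abs_le] at h0 h1 h2
    have hA : |c₂ - 2 * c₁ + c₀| ≤ 16 * b ^ 2 := by
      rw [abs_le]; constructor <;> nlinarith
    have hB' : |c₁ - c₀| ≤ 16 * b ^ 2 := by
      rw [abs_le]; constructor <;> nlinarith
    filter_upwards [hP.condVar_eq hY hm hB hM, hties] with ω hω hy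
    rw [hω, hvar _ hy, hV]
    set m := mutualCount (window n L) k fun i => Y i ω
    set d := inDegSq (window n L) k fun i => Y i ω
    set m' := ∫ ω', mutualCount (window n L) k (fun i => Y i ω') ∂μ
    set d' := ∫ ω', inDegSq (window n L) k (fun i => Y i ω') ∂μ
    have e : (c₂ - 2 * c₁ + c₀) * (k * L + m) + (c₁ - c₀) * (3 * k ^ 2 * L + d)
          + c₀ * (k ^ 2 * L ^ 2)
        - ((c₂ - 2 * c₁ + c₀) * (k * L + m') + (c₁ - c₀) * (3 * k ^ 2 * L + d')
          + c₀ * (k ^ 2 * L ^ 2)) = (c₂ - 2 * c₁ + c₀) * (m - m') + (c₁ - c₀) * (d - d') := by ring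
    rw [e, mul_add]
    refine (abs_add_le _ _).trans (add_le_add ?_ ?_)
    · rw [abs_mul]; exact mul_le_mul_of_nonneg_right hA (abs_nonneg _)
    · rw [abs_mul]; exact mul_le_mul_of_nonneg_right hB' (abs_nonneg _)
  · rw [hP.integral_eq_of_favg hY hm hB hM]
    refine hP.measureReal_abs_sub_ge_le hY hm hM (by positivity) (by omega) hn ?_ hr
    filter_upwards [hties, hdeg] with ω hy hω u v σ
    refine abs_sum_mul_swap_sub_le (A := fun i j : (window n L) => knnInd (window n L) (fun i => Y i ω) k i j)
      (fun i j => knnInd_nonneg _ _ _ _ _) (fun i => (hrow _ hy i).le) (fun j => ?_) hb0.le hb u v σ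
    rw [Finset.sum_coe_sort (window n L) fun i => knnInd (window n L) (fun i => Y i ω) k i j]
    exact hω j j.2

end QuadraticForm

/-- Conditional and unconditional standardization of a quadratic form over the nearest neighbour
graph are asymptotically equivalent as soon as the variance is at least of order `L`. -/
theorem ae_tendsto_condStandardized_sub_standardized {Ω E : Type*} [MeasurableSpace Ω]
    [MetricSpace E] [MeasurableSpace E] {μ : Measure Ω} [IsProbabilityMeasure μ] {Y : ℕ → Ω → E}
    {ν : Measure E} [IsProbabilityMeasure ν]
    (hdist : Measurable fun p : E × E => dist p.1 p.2) (hY : Measurable fun ω i => Y i ω)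
    (hlaw : μ.map (fun ω i => Y i ω) = Measure.infinitePi fun _ : ℕ => ν)
    (hties : ∀ᵐ ω ∂μ, NoTies fun m => Y m ω) {k : ℕ} (hk : 1 ≤ k) {C : ℝ} (hC : 1 ≤ C)
    {n : ℕ → ℕ} (hdeg : ∀ L, ∀ᵐ ω ∂μ, InDegLE (window (n L) L) k C fun m => Y m ω)
    (hn : ∀ L, L ≤ n L)
    {P : (L : ℕ) → Ω → Equiv.Perm (window (n L) L)} (hP : ∀ L, IsUniformPerm μ Y (P L))
    {Φ : (L : ℕ) → window (n L) L → window (n L) L → ℝ} {b c : ℝ} (hb : 0 < b) (hc : 0 < c)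
    (h : ∀ᶠ L : ℕ in atTop, (∀ i j, |Φ L i j| ≤ b) ∧ ∃ a c₀ c₁ c₂ : ℝ, |a| ≤ b ∧
      PairMoments (fun i j => Φ L i j - a) c₀ c₁ c₂ ∧
      c * L ≤ (c₂ - 2 * c₁ + c₀)
            * (k * L + ∫ ω, mutualCount (window (n L) L) k (fun i => Y i ω) ∂μ)
          + (c₁ - c₀) * (3 * k ^ 2 * L + ∫ ω, inDegSq (window (n L) L) k (fun i => Y i ω) ∂μ)
          + c₀ * (k ^ 2 * L ^ 2)) :
    ∀ᵐ ω ∂μ, Tendsto (fun L : ℕ =>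
        condStandardized μ Y (fun ω' => graphForm k (Φ L) (fun i => Y i ω') (P L ω')) ω -
          standardized μ (fun ω' => graphForm k (Φ L) (fun i => Y i ω') (P L ω')) ω)
      atTop (𝓝 0) := by
  have hk0 : (1 : ℝ) ≤ k := by exact_mod_cast hk
  set R : ℕ → Ω → ℝ := fun L ω => graphForm k (Φ L) (fun i => Y i ω) (P L ω) with hR
  set V : ℕ → Ω → ℝ := fun L =>
    condVar (MeasurableSpace.comap (fun ω' i => Y i ω') MeasurableSpace.pi) (R L) μ with hVdef
  set m : ℕ → Ω → ℝ := fun L ω => |mutualCount (window (n L) L) k (fun i => Y i ω)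
            - ∫ ω', mutualCount (window (n L) L) k (fun i => Y i ω') ∂μ| with hm
  set d : ℕ → Ω → ℝ := fun L ω => |inDegSq (window (n L) L) k (fun i => Y i ω)
            - ∫ ω', inDegSq (window (n L) L) k (fun i => Y i ω') ∂μ| with hd
  have hfacts : ∀ᶠ L : ℕ in atTop,
      (∀ᵐ ω ∂μ, |V L ω - variance (R L) μ| ≤ 16 * b ^ 2 * (m L ω + d L ω)) ∧
      c * L ≤ variance (R L) μ ∧ ∀ r : ℝ, 0 ≤ r → μ.real {ω | r ≤ |R L ω - ∫ ω', R L ω' ∂μ|}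
        ≤ 2 * Real.exp (-r ^ 2 / (2 * ((4 * b * (k + C)) ^ 2 * L))) := by
    filter_upwards [h, eventually_ge_atTop 4, eventually_gt_atTop k] with L hL h4 hkL
    obtain ⟨hΦ, a, c₀, c₁, c₂, ha, H, hlow⟩ := hL
    obtain ⟨f1, f2, f3⟩ := graphForm_moments hdist hY hties (hdeg L) h4 hkL (hn L) (hP L) hC hb hΦ
      ha H
    exact ⟨f1, f2 ▸ hlow, f3⟩
  obtain ⟨N, hN⟩ := eventually_atTop.1 hfacts
  have hRae := ae_eventually_abs_le_sqrt_mul_log (μ := μ) (c := 4 * b * (k + C))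
    (X := fun L ω => R L ω - ∫ ω', R L ω' ∂μ) (by positivity) (hfacts.mono fun L hL => hL.2.2)
  have hmae := ae_eventually_abs_sub_integral_le hdist hY hlaw hties hdeg hn
    (f := fun S => mutualCount S k) (fun S => measurable_mutualCount hdist S k)
    (fun S => ⟨_, abs_mutualCount_le S k⟩) (fun S y y' hyy => mutualCount_congr hyy k)
    (c := 4 * k * (C + 1)) (by positivity)
    fun S y hy hS i hi => abs_mutualCount_sub_erase_le hy hi hS
  have hdae := ae_eventually_abs_sub_integral_le hdist hY hlaw hties hdeg hn
    (f := fun S => inDegSq S k) (fun S => measurable_inDegSq hdist S k)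
    (fun S => ⟨_, abs_inDegSq_le S k⟩) (fun S y y' hyy => inDegSq_congr hyy k)
    (c := (3 * C + 1) * (2 * k * (C + 1))) (by positivity)
    fun S y hy hS i hi => abs_inDegSq_sub_erase_le hy hi hS
  -- The conditional variance is defined up to null sets for each `L`; countably many exceptional
  -- sets are merged here.
  have hVae : ∀ᵐ ω ∂μ, ∀ L, N ≤ L →
      |V L ω - variance (R L) μ| ≤ 16 * b ^ 2 * (m L ω + d L ω) := by
    rw [ae_all_iff]
    intro L
    by_cases hNL : N ≤ L
    · filter_upwards [(hN L hNL).1] with ω hω _ using hω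
    · exact ae_of_all _ fun ω h' => absurd h' hNL
  set K₁ := 2 * (4 * b * (k + C)) with hK₁
  set K₂ := 16 * b ^ 2 * (2 * (4 * k * (C + 1)) + 2 * ((3 * C + 1) * (2 * k * (C + 1)))) with hK₂
  have hK₁0 : 0 ≤ K₁ := by positivity
  have hK₂0 : 0 ≤ K₂ := by positivity
  filter_upwards [hRae, hmae, hdae, hVae] with ω h1 h2 h3 h4
  refine tendsto_div_sqrt_sub_div_sqrt (x := fun L => R L ω - ∫ ω', R L ω' ∂μ)
    (V := fun L => V L ω) (v := fun L => variance (R L) μ) (K := K₁ + K₂) (by positivity) hc ?_ ?_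
    (hfacts.mono fun L hL => hL.2.1)
  · filter_upwards [h1] with L hL
    exact hL.trans (mul_le_mul_of_nonneg_right (by linarith) (Real.sqrt_nonneg _))
  · filter_upwards [h2, h3, eventually_ge_atTop N] with L h2 h3 hL
    calc |V L ω - variance (R L) μ| ≤ 16 * b ^ 2 * (m L ω + d L ω) := h4 L hL
      _ ≤ 16 * b ^ 2 * (2 * (4 * k * (C + 1)) * √(L * Real.log L)
          + 2 * ((3 * C + 1) * (2 * k * (C + 1))) * √(L * Real.log L)) :=
        mul_le_mul_of_nonneg_left (add_le_add h2 h3) (by positivity)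
      _ = K₂ * √(L * Real.log L) := by rw [hK₂]; ring
      _ ≤ _ := mul_le_mul_of_nonneg_right (by linarith) (Real.sqrt_nonneg _)

/-! ### Pair moments of the two-sample kernels -/

section TwoSample

variable {α : Type*} [Fintype α] [DecidableEq α] {x : α → ℝ} {m N : ℝ}

omit [DecidableEq α] in
theorem sum_centred_eq_zero (hsum : ∑ a, x a = m) (hN : (Fintype.card α : ℝ) = N) (hN0 : N ≠ 0) :
    ∑ a, (x a - m / N) = 0 := by
  rw [Finset.sum_sub_distrib, hsum, Finset.sum_const, nsmul_eq_mul, Finset.card_univ, hN]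
  field_simp
  ring

omit [DecidableEq α] in
theorem sum_centred_sq (hx : ∀ a, x a = 0 ∨ x a = 1) (hsum : ∑ a, x a = m)
    (hN : (Fintype.card α : ℝ) = N) (hN0 : N ≠ 0) :
    ∑ a, (x a - m / N) ^ 2 = m * (1 - m / N) := by
  have : ∀ a, (x a - m / N) ^ 2 = x a * (1 - 2 * (m / N)) + (m / N) ^ 2 := fun a => by
    rcases hx a with h | h <;> rw [h] <;> ring
  simp_rw [this]
  rw [Finset.sum_add_distrib, ← Finset.sum_mul, hsum, Finset.sum_const, nsmul_eq_mul,
    Finset.card_univ, hN]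
  field_simp
  ring

/-- The quadratic terms cancel: `x a * x b - (1 - x a) * (1 - x b) = x a + x b - 1`, so the centred
kernel is additive. -/
theorem pairMoments_diff (hx : ∀ a, x a = 0 ∨ x a = 1) (hsum : ∑ a, x a = m)
    (hN : (Fintype.card α : ℝ) = N) (hN0 : N ≠ 0) {v w : ℝ} (hv : v = 4 * (m / N) * (1 - m / N))
    (hw : w = -v / (N - 1)) :
    PairMoments (fun a b => 2 * (x a * x b - (1 - x a) * (1 - x b)) - 2 * (2 * (m / N) - 1))
      (4 * w) (v + 3 * w) (2 * v + 2 * w) := by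
  have h0 := sum_centred_eq_zero hsum hN hN0
  have h2 := sum_centred_sq hx hsum hN hN0
  have e : (fun a b => 2 * (x a * x b - (1 - x a) * (1 - x b)) - 2 * (2 * (m / N) - 1))
      = fun a b => 2 * (x a - m / N) + 2 * (x b - m / N) := by
    funext a b; ring
  rw [e]
  refine pairMoments_add (u := fun a => 2 * (x a - m / N)) ?_ ?_ (by rw [hN]; exact hw)
  · rw [← Finset.mul_sum, h0, mul_zero]
  · simp_rw [mul_pow]
    rw [← Finset.mul_sum, h2, hN, hv]
    field_simp
    ring

/-- The off-diagonal row sums of the uncentred kernel are `2 (1 - p) (m - 1)` in the first sample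
and `2 p (N - 1 - m)` in the second; they agree exactly for this `p`, and `κ` is their common
average. The bound on `c₂` comes from mixed pairs, where the kernel equals `-κ`. -/
theorem pairMoments_weighted (hx : ∀ a, x a = 0 ∨ x a = 1) (hsum : ∑ a, x a = m)
    (hN : (Fintype.card α : ℝ) = N) (hN4 : 4 ≤ N) {p κ : ℝ} (hp : p = (m - 1) / (N - 2))
    (hκ : κ = 2 * p * ((N - 1 - m) / (N - 1))) (hm0 : 0 ≤ m) (hmN : m ≤ N) :
    ∃ c₂ : ℝ, 2 * ((m / N) * (1 - m / N)) * κ ^ 2 ≤ c₂ ∧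
      PairMoments (fun a b => 2 * ((1 - p) * (x a * x b) + p * ((1 - x a) * (1 - x b))) - κ)
        (2 * c₂ / ((N - 2) * (N - 3))) (-c₂ / (N - 2)) c₂ := by
  have hN0 : N ≠ 0 := by linarith
  have hcard : 4 ≤ Fintype.card α := by
    have : (4 : ℝ) ≤ Fintype.card α := by rw [hN]; exact hN4
    exact_mod_cast this
  have hsq : ∑ a, x a * x a = m := by
    rw [← hsum]
    refine Finset.sum_congr rfl fun a _ => ?_
    rcases hx a with h | h <;> rw [h] <;> ring
  obtain ⟨c₂, H⟩ := pairMoments_of_row_sum_zero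
    (h := fun a b => 2 * ((1 - p) * (x a * x b) + p * ((1 - x a) * (1 - x b))) - κ)
    (fun a b => by ring) (fun a => by
      have hu : ∑ b, (2 * ((1 - p) * (x a * x b) + p * ((1 - x a) * (1 - x b))) - κ)
          = 2 * ((1 - p) * (x a * m) + p * ((1 - x a) * (N - m))) - N * κ := by
        rw [Finset.sum_sub_distrib, ← Finset.mul_sum, Finset.sum_add_distrib, ← Finset.mul_sum,
          ← Finset.mul_sum, ← Finset.mul_sum, ← Finset.mul_sum, Finset.sum_sub_distrib, hsum]
        simp [hN]
      have h1 := Finset.add_sum_erase Finset.univ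
        (fun b => 2 * ((1 - p) * (x a * x b) + p * ((1 - x a) * (1 - x b))) - κ)
        (Finset.mem_univ a)
      rw [hu] at h1
      have e1 : N - 2 ≠ 0 := by linarith
      have e2 : N - 1 ≠ 0 := by linarith
      rcases hx a with h | h
      · simp only [h] at h1 ⊢
        have : (2 * ((1 - p) * (0 * m) + p * ((1 - 0) * (N - m))) - N * κ)
            - (2 * ((1 - p) * (0 * 0) + p * ((1 - 0) * (1 - 0))) - κ) = 0 := by
          rw [hκ]; field_simp; ring
        linarith
      · simp only [h] at h1 ⊢
        have : (2 * ((1 - p) * (1 * m) + p * ((1 - 1) * (N - m))) - N * κ)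
            - (2 * ((1 - p) * (1 * 1) + p * ((1 - 1) * (1 - 1))) - κ) = 0 := by
          rw [hκ, hp]; field_simp; ring
        linarith) hcard
  rw [hN] at H
  refine ⟨c₂, ?_, H⟩
  obtain ⟨i, j, hij⟩ := Fintype.exists_pair_of_one_lt_card (α := α) (by omega)
  have hone : ∀ i, favg (fun σ : Equiv.Perm α => x (σ i)) = m / N := fun i => by
    rw [favg_perm_apply, hsum, hN]; field_simp
  have htwo := favg_perm_apply_mul_apply (sum_centred_eq_zero hsum hN hN0) hij
  rw [sum_centred_sq hx hsum hN hN0, hN] at htwo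
  -- Sampling without replacement is negatively correlated, so a mixed pair is at least as likely as
  -- under independence.
  have hcov : favg (fun σ : Equiv.Perm α => (x (σ i) - m / N) * (x (σ j) - m / N)) ≤ 0 := by
    rw [htwo]
    refine div_nonpos_of_nonpos_of_nonneg ?_ (by linarith)
    have : 0 ≤ 1 - m / N := sub_nonneg.2 ((div_le_one (by linarith)).2 hmN)
    rw [neg_nonpos]
    have : 0 ≤ N := by linarith
    positivity
  have hmixed : 2 * ((m / N) * (1 - m / N))
      ≤ favg (fun σ : Equiv.Perm α => x (σ i) + x (σ j) - 2 * (x (σ i) * x (σ j))) := by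
    have e : ∀ σ : Equiv.Perm α, x (σ i) + x (σ j) - 2 * (x (σ i) * x (σ j))
        = (1 - 2 * (m / N)) * (x (σ i) + x (σ j)) + 2 * (m / N) ^ 2
          - 2 * ((x (σ i) - m / N) * (x (σ j) - m / N)) := fun σ => by ring
    simp_rw [e]
    rw [favg_sub, favg_add, favg_const_mul, favg_add, hone, hone, favg_const, favg_const_mul]
    nlinarith
  calc 2 * ((m / N) * (1 - m / N)) * κ ^ 2
      ≤ favg (fun σ : Equiv.Perm α => x (σ i) + x (σ j) - 2 * (x (σ i) * x (σ j))) * κ ^ 2 :=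
        mul_le_mul_of_nonneg_right hmixed (sq_nonneg _)
    _ = favg (fun σ : Equiv.Perm α => (x (σ i) + x (σ j) - 2 * (x (σ i) * x (σ j))) * κ ^ 2) :=
        (favg_mul_const _ _).symm
    _ ≤ _ := by
        rw [← H.same i j hij]
        refine favg_mono fun σ => ?_
        rcases hx (σ i) with h | h <;> rcases hx (σ j) with h' | h' <;> simp only [h, h'] <;>
          nlinarith [sq_nonneg κ, mul_self_nonneg (2 * ((1 - p) * (1 * 1)
            + p * ((1 - 1) * (1 - 1))) - κ), mul_self_nonneg (2 * ((1 - p) * (0 * 0)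
            + p * ((1 - 0) * (1 - 0))) - κ)]

end TwoSample

/-! ### Edge counts as quadratic forms -/

section EdgeCounts

/-- Indicator of the first sample. -/
noncomputable def fstInd (t : ℕ) (i : ℕ) : ℝ := if i ≤ t then 1 else 0

theorem fstInd_eq_zero_or_one (t i : ℕ) : fstInd t i = 0 ∨ fstInd t i = 1 := by
  unfold fstInd; split_ifs <;> simp

theorem bFst_eq (t i j : ℕ) : bFst t i j = fstInd t i * fstInd t j := by
  unfold bFst fstInd
  split_ifs <;> simp_all

theorem bSnd_eq (t i j : ℕ) : bSnd t i j = (1 - fstInd t i) * (1 - fstInd t j) := by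
  unfold bSnd fstInd
  split_ifs <;> simp_all <;> omega

theorem sum_fstInd {n t L : ℕ} (hn : L ≤ n) (ht : t ∈ window n L) :
    ∑ i : window n L, fstInd t i = (t : ℝ) - ((n : ℝ) - L) := by
  rw [Finset.sum_coe_sort (window n L) (fstInd t)]
  unfold fstInd
  rw [Finset.sum_boole]
  rw [Finset.mem_Ioc] at ht
  have : (window n L).filter (fun i => i ≤ t) = Finset.Ioc (n - L) t := by
    ext i
    simp only [Finset.mem_filter, Finset.mem_Ioc]
    omega
  rw [this, Nat.card_Ioc, Nat.cast_sub (by omega), Nat.cast_sub hn]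

variable {E : Type*} [MetricSpace E]

theorem sum_symm_eq_graphForm {k n L : ℕ} (g : ℕ → ℕ → ℝ) (hg : ∀ i j, g i j = g j i) (y : ℕ → E)
    (σ : Equiv.Perm (window n L)) :
    ∑ i : window n L, ∑ j : window n L,
      (knnInd (window n L) y k i j + knnInd (window n L) y k j i) * g (σ i) (σ j)
      = graphForm k (fun i j => 2 * g i j) y σ := by
  simp_rw [add_mul, Finset.sum_add_distrib]
  rw [Finset.sum_comm (f := fun i j : window n L => knnInd (window n L) y k j i * g (σ i) (σ j)),
    graphForm, ← Finset.sum_add_distrib]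
  refine Finset.sum_congr rfl fun i _ => ?_
  rw [← Finset.sum_add_distrib]
  refine Finset.sum_congr rfl fun j _ => ?_
  rw [hg (σ j)]; ring

theorem edgeDiff_eq_graphForm (k t n L : ℕ) (y : ℕ → E) (σ : Equiv.Perm (window n L)) :
    edgeDiff k t n L y σ = graphForm k (fun i j => 2 * (fstInd t i * fstInd t j
      - (1 - fstInd t i) * (1 - fstInd t j))) y σ := by
  rw [← sum_symm_eq_graphForm (fun i j => fstInd t i * fstInd t j
    - (1 - fstInd t i) * (1 - fstInd t j)) (fun i j => by ring)]
  simp_rw [edgeDiff, edgeCount1, edgeCount2, ← Finset.sum_sub_distrib, bFst_eq, bSnd_eq, mul_sub]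

theorem edgeWeighted_eq_graphForm (k t n L : ℕ) (y : ℕ → E) (σ : Equiv.Perm (window n L)) :
    edgeWeighted k t n L y σ = graphForm k (fun i j => 2 * ((1 - weightP t n L)
      * (fstInd t i * fstInd t j)
      + weightP t n L * ((1 - fstInd t i) * (1 - fstInd t j)))) y σ := by
  rw [← sum_symm_eq_graphForm (fun i j => (1 - weightP t n L) * (fstInd t i * fstInd t j)
    + weightP t n L * ((1 - fstInd t i) * (1 - fstInd t j))) (fun i j => by ring)]
  simp_rw [edgeWeighted, edgeCount1, edgeCount2, Finset.mul_sum, ← Finset.sum_add_distrib, bFst_eq,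
    bSnd_eq]
  refine Finset.sum_congr rfl fun i _ => Finset.sum_congr rfl fun j _ => ?_
  ring

/-- The diagonal `j = l` of the squared in-degrees counts edges. This links the variance to
`q_{k,L}`. -/
theorem inDegSq_eq {S : Finset ℕ} {k : ℕ} {y : ℕ → E} (hy : NoTies y) (hk : k < S.card) :
    inDegSq S k y = (∑ i ∈ S, ∑ j ∈ S, ∑ l ∈ S.erase j, knnInd S y k j i * knnInd S y k l i)
      + k * S.card := by
  have htot : ∑ i ∈ S, ∑ j ∈ S, knnInd S y k j i = k * S.card := by
    rw [Finset.sum_comm, Finset.sum_congr rfl fun j hj => sum_knnInd_eq hy hj hk, Finset.sum_const,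
      nsmul_eq_mul, mul_comm]
  rw [← htot, inDegSq, ← Finset.sum_add_distrib]
  refine Finset.sum_congr rfl fun i _ => ?_
  rw [sq, Finset.sum_mul, ← Finset.sum_add_distrib]
  refine Finset.sum_congr rfl fun j hj => ?_
  rw [← Finset.mul_sum, ← Finset.add_sum_erase S _ hj, mul_add, knnInd_mul_self]
  ring

theorem inDegSq_le {S : Finset ℕ} {k : ℕ} {C : ℝ} {y : ℕ → E} (hC : InDegLE S k C y) :
    inDegSq S k y ≤ C ^ 2 * S.card := by
  rw [inDegSq, mul_comm, ← nsmul_eq_mul]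
  exact Finset.sum_le_card_nsmul _ _ _ fun j hj => pow_le_pow_left₀
    (Finset.sum_nonneg fun i _ => knnInd_nonneg _ _ _ _ _) (hC j hj) 2

end EdgeCounts

/-! ### Lower bounds for the variances and conclusion -/

theorem exists_eventually_mul_le {f : ℕ → ℝ} (hf : f =Θ[atTop] fun L : ℕ => (L : ℝ))
    (hpos : ∀ᶠ L in atTop, 0 ≤ f L) : ∃ ε : ℝ, 0 < ε ∧ ∀ᶠ L : ℕ in atTop, ε * L ≤ f L := by
  obtain ⟨K, hK, h⟩ := hf.2.exists_pos
  refine ⟨K⁻¹, inv_pos.2 hK, ?_⟩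
  filter_upwards [h.bound, hpos] with L h1 h2
  rw [Real.norm_of_nonneg h2, Real.norm_of_nonneg (Nat.cast_nonneg L)] at h1
  rw [inv_mul_le_iff₀ hK]
  exact h1

/-- The main term is at least `c₂ N`. The shared-point moment is only of order `c₂ / N`, so the
degree term costs at most half of that once `N ≥ 6 D + 4`; the disjoint-pair term is nonnegative. -/
theorem le_weighted_variance {c₂ k N u d D : ℝ} (hc : 0 ≤ c₂) (hk : 1 ≤ k) (hu : 0 ≤ u)
    (hD : 0 < D) (hd : 3 * k ^ 2 * N + d ≤ D * N) (hN : 6 * D + 4 ≤ N) :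
    c₂ / 2 * N ≤ (c₂ - 2 * (-c₂ / (N - 2)) + 2 * c₂ / ((N - 2) * (N - 3))) * (k * N + u)
      + (-c₂ / (N - 2) - 2 * c₂ / ((N - 2) * (N - 3))) * (3 * k ^ 2 * N + d)
      + 2 * c₂ / ((N - 2) * (N - 3)) * (k ^ 2 * N ^ 2) := by
  have h2 : 1 < N - 2 := by linarith
  have h3 : 6 * D < N - 3 := by linarith
  have hN0 : 0 < N := by linarith
  set a := 1 / (N - 2) with ha
  set a' := 2 / ((N - 2) * (N - 3)) with ha'
  have h3' : 0 < N - 3 := by linarith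
  have ha0 : 0 ≤ a := by rw [ha]; positivity
  have ha'0 : 0 ≤ a' := by rw [ha']; positivity
  have hsum : (a + a') * D ≤ 1 / 2 := by
    have e : (a + a') = (N - 1) / ((N - 2) * (N - 3)) := by
      rw [ha, ha']; field_simp; ring
    rw [e, div_mul_eq_mul_div, div_le_iff₀ (by positivity)]
    nlinarith
  have e : (c₂ - 2 * (-c₂ / (N - 2)) + 2 * c₂ / ((N - 2) * (N - 3))) * (k * N + u)
      + (-c₂ / (N - 2) - 2 * c₂ / ((N - 2) * (N - 3))) * (3 * k ^ 2 * N + d)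
      + 2 * c₂ / ((N - 2) * (N - 3)) * (k ^ 2 * N ^ 2)
      = c₂ * ((1 + 2 * a + a') * (k * N + u) - (a + a') * (3 * k ^ 2 * N + d)
        + a' * (k ^ 2 * N ^ 2)) := by
    rw [ha, ha']; field_simp; ring
  rw [e, div_mul_eq_mul_div, mul_div_assoc]
  refine mul_le_mul_of_nonneg_left ?_ hc
  have i1 : N ≤ (1 + 2 * a + a') * (k * N + u) := by
    have : N ≤ k * N + u := by nlinarith
    nlinarith
  have i2 : (a + a') * (3 * k ^ 2 * N + d) ≤ 1 / 2 * N := by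
    calc (a + a') * (3 * k ^ 2 * N + d) ≤ (a + a') * (D * N) :=
          mul_le_mul_of_nonneg_left hd (by linarith)
      _ = (a + a') * D * N := by ring
      _ ≤ _ := mul_le_mul_of_nonneg_right hsum hN0.le
  have i3 : 0 ≤ a' * (k ^ 2 * N ^ 2) := by positivity
  linarith

/-- For an additive kernel the coefficient of the mutual pairs is zero, and the variance collapses
to `v (d - k² N) N / (N - 1)`. Since in-degrees average `k`, the middle factor is their total
squared deviation from `k`, in expectation. -/
theorem le_diff_variance {v w k N u d δ : ℝ} (hv : 0 ≤ v) (hN : 1 < N) (hw : w = -v / (N - 1))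
    (hδ : 0 ≤ δ) (hd : (k ^ 2 + δ) * N ≤ d) :
    v * δ * N ≤ (2 * v + 2 * w - 2 * (v + 3 * w) + 4 * w) * (k * N + u)
      + (v + 3 * w - 4 * w) * (3 * k ^ 2 * N + d) + 4 * w * (k ^ 2 * N ^ 2) := by
  have h1 : 0 < N - 1 := by linarith
  have e : (2 * v + 2 * w - 2 * (v + 3 * w) + 4 * w) * (k * N + u)
      + (v + 3 * w - 4 * w) * (3 * k ^ 2 * N + d) + 4 * w * (k ^ 2 * N ^ 2)
      = v * (d - k ^ 2 * N) * (N / (N - 1)) := by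
    rw [hw]; field_simp; ring
  rw [e]
  have h2 : 1 ≤ N / (N - 1) := by rw [one_le_div h1]; linarith
  have h3 : δ * N ≤ d - k ^ 2 * N := by linarith
  have h4 : 0 ≤ δ * N := by positivity
  calc v * δ * N = v * (δ * N) := by ring
    _ ≤ v * (d - k ^ 2 * N) := mul_le_mul_of_nonneg_left h3 hv
    _ ≤ _ := le_mul_of_one_le_right (mul_nonneg hv (h4.trans h3)) h2

theorem mainTheorem4 {Ω E : Type*} [MeasurableSpace Ω] (μ : Measure Ω) [IsProbabilityMeasure μ]
    [MetricSpace E] [MeasurableSpace E]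
    (hdist : Measurable fun p : E × E => dist p.1 p.2)
    (Y : ℕ → Ω → E) (hYmeas : ∀ i, Measurable (Y i)) (hYindep : iIndepFun Y μ)
    (hYident : ∀ i, IdentDistrib (Y i) (Y 1) μ μ)
    (hties : ∀ i j l, i ≠ j → i ≠ l → j ≠ l →
      ∀ᵐ ω ∂μ, dist (Y i ω) (Y j ω) ≠ dist (Y i ω) (Y l ω))
    (k : ℕ) (hk : 1 ≤ k) (hdeg : BoundedInDegree μ Y k)
    (n t : ℕ → ℕ) (hn : ∀ L, L ≤ n L) (ht : ∀ L, 1 ≤ L → t L ∈ window (n L) L)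
    (hfst : (fun L : ℕ => (t L : ℝ) - ((n L : ℝ) - L)) =Θ[atTop] fun L : ℕ => (L : ℝ))
    (hsnd : (fun L : ℕ => (n L : ℝ) - t L) =Θ[atTop] fun L : ℕ => (L : ℝ))
    (P : (L : ℕ) → Ω → Equiv.Perm (window (n L) L)) (hP : ∀ L, IsUniformPerm μ Y (P L)) :
    (∀ᵐ ω ∂μ, Tendsto (fun L : ℕ =>
        condStandardized μ Y
            (fun ω' => edgeWeighted k (t L) (n L) L (fun i => Y i ω') (P L ω')) ω -
          standardized μ
            (fun ω' => edgeWeighted k (t L) (n L) L (fun i => Y i ω') (P L ω')) ω)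
      atTop (𝓝 0)) ∧
    ((∃ δ : ℝ, 0 < δ ∧ ∀ᶠ L : ℕ in atTop,
        (k : ℝ) ^ 2 - k + δ ≤ sharedNN μ Y k (n L) L) →
      ∀ᵐ ω ∂μ, Tendsto (fun L : ℕ =>
        condStandardized μ Y
            (fun ω' => edgeDiff k (t L) (n L) L (fun i => Y i ω') (P L ω')) ω -
          standardized μ
            (fun ω' => edgeDiff k (t L) (n L) L (fun i => Y i ω') (P L ω')) ω)
      atTop (𝓝 0)) := by
  have hk1 : (1 : ℝ) ≤ k := by exact_mod_cast hk
  have hY : Measurable fun ω i => Y i ω := measurable_pi_iff.2 hYmeas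
  have : IsProbabilityMeasure (μ.map (Y 1)) :=
    Measure.isProbabilityMeasure_map (hYmeas 1).aemeasurable
  have hlaw := map_eq_infinitePi_of_iid hYmeas hYindep hYident
  have hnt : ∀ᵐ ω ∂μ, NoTies fun m => Y m ω := by
    simp only [NoTies, ae_all_iff]
    exact hties
  obtain ⟨C, hC, hdeg⟩ := hdeg
  have hwin : ∀ L, ∀ᵐ ω ∂μ, InDegLE (window (n L) L) k C fun m => Y m ω := fun L =>
    ae_inDegLE_window hdist hY hlaw (hdeg.mono fun ω h => h L) (hn L)
  set m : ℕ → ℝ := fun L => (t L : ℝ) - ((n L : ℝ) - L) with hm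
  have hbd : ∀ L, 1 ≤ L → 0 ≤ m L ∧ 0 ≤ (n L : ℝ) - t L := fun L hL => by
    have h1 := Finset.mem_Ioc.1 (ht L hL)
    have h2 : n L ≤ t L + L := by omega
    have h2' : (n L : ℝ) ≤ t L + L := by exact_mod_cast h2
    have h3 : (t L : ℝ) ≤ n L := by exact_mod_cast h1.2
    simp only [hm]
    exact ⟨by linarith, by linarith⟩
  obtain ⟨ε₁, hε₁, h₁⟩ := exists_eventually_mul_le hfst
    ((eventually_ge_atTop 1).mono fun L hL => (hbd L hL).1)
  obtain ⟨ε₂, hε₂, h₂⟩ := exists_eventually_mul_le hsnd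
    ((eventually_ge_atTop 1).mono fun L hL => (hbd L hL).2)
  obtain ⟨ε, hε, hεm⟩ : ∃ ε : ℝ, 0 < ε ∧ ∀ᶠ L : ℕ in atTop, ε * L ≤ m L ∧ m L ≤ (1 - ε) * L := by
    refine ⟨min ε₁ ε₂, lt_min hε₁ hε₂, ?_⟩
    filter_upwards [h₁, h₂] with L h1 h2
    have hL0 : (0 : ℝ) ≤ L := Nat.cast_nonneg L
    have h3 := mul_le_mul_of_nonneg_right (min_le_left ε₁ ε₂) hL0
    have h4 := mul_le_mul_of_nonneg_right (min_le_right ε₁ ε₂) hL0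
    simp only [hm] at h1 ⊢
    exact ⟨by linarith, by linarith⟩
  have hcard : ∀ L, (Fintype.card (window (n L) L) : ℝ) = L := fun L => by
    rw [Fintype.card_coe, card_window (hn L)]
  have hmL : ∀ L, 1 ≤ L → ∑ i : window (n L) L, fstInd (t L) i = m L := fun L hL =>
    sum_fstInd (hn L) (ht L hL)
  have hfrac : ∀ L : ℕ, 0 < (L : ℝ) → ε * L ≤ m L ∧ m L ≤ (1 - ε) * L →
      ε ≤ m L / L ∧ ε ≤ 1 - m L / L := fun L hL h => by
    have h2 : m L / L ≤ 1 - ε := (div_le_iff₀ hL).2 h.2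
    exact ⟨(le_div_iff₀ hL).2 h.1, by linarith⟩
  constructor
  · simp_rw [edgeWeighted_eq_graphForm]
    refine ae_tendsto_condStandardized_sub_standardized (Φ := fun L i j =>
      2 * ((1 - weightP (t L) (n L) L) * (fstInd (t L) i * fstInd (t L) j)
      + weightP (t L) (n L) L * ((1 - fstInd (t L) i) * (1 - fstInd (t L) j))))
      hdist hY hlaw hnt hk hC hwin hn hP (b := 2)
      -- Half of the lower bound `2 ε² κ²` for `c₂`, where `κ ≥ ε² / 2` because both factors of `κ /
      -- 2` are at least `ε / 2`.
      (c := 2 * (ε * ε) * (ε ^ 2 / 2) ^ 2 / 2) two_pos (by positivity) ?_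
    have hlarge : ∀ D : ℝ, ∀ᶠ L : ℕ in atTop, D ≤ (L : ℝ) := fun D =>
      tendsto_natCast_atTop_atTop.eventually_ge_atTop D
    -- The first size condition feeds `le_weighted_variance`; `ε L ≥ 2` absorbs the `-1` in the
    -- numerators of `p` and of the second factor of `κ`.
    filter_upwards [hεm, hlarge (6 * (3 * k ^ 2 + C ^ 2) + 4), hlarge (2 / ε),
      eventually_ge_atTop 1] with L hL hL1 hL2 hL3
    have hC2 : 0 < C ^ 2 := by positivity
    have hN4 : (4 : ℝ) ≤ L := by nlinarith
    have hN0 : (0 : ℝ) < L := by linarith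
    have hεL : 2 ≤ ε * L := by rwa [div_le_iff₀' hε] at hL2
    obtain ⟨hf1, hf2⟩ := hfrac L hN0 hL
    set p := weightP (t L) (n L) L with hp
    have hpe : p = (m L - 1) / (L - 2) := rfl
    have hL2' : (0 : ℝ) < L - 2 := by linarith
    have hp1 : p ≤ 1 := by
      rw [hpe, div_le_one hL2']; linarith
    have hpε : ε / 2 ≤ p := by
      rw [hpe, le_div_iff₀ hL2']; nlinarith
    have hr1 : (L - 1 - m L) / ((L : ℝ) - 1) ≤ 1 := by
      rw [div_le_one (by linarith)]; linarith
    have hrε : ε / 2 ≤ (L - 1 - m L) / ((L : ℝ) - 1) := by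
      rw [le_div_iff₀ (by linarith)]; nlinarith
    set κ := 2 * p * ((L - 1 - m L) / ((L : ℝ) - 1)) with hκ
    have hκε : ε ^ 2 / 2 ≤ κ := by
      rw [hκ]; nlinarith [mul_le_mul hpε hrε (by positivity) (by linarith)]
    have hκ2 : κ ≤ 2 := by
      rw [hκ]; nlinarith [mul_le_mul hp1 hr1 (by linarith) zero_le_one]
    obtain ⟨c₂, hc₂, H⟩ := pairMoments_weighted (x := fun i : window (n L) L => fstInd (t L) i)
      (fun i => fstInd_eq_zero_or_one _ _) (hmL L hL3) (hcard L) hN4 hpe hκ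
      (by linarith [hL.1]) (by linarith [hL.2])
    have hc₂ε : 2 * (ε * ε) * (ε ^ 2 / 2) ^ 2 ≤ c₂ := by
      refine le_trans ?_ hc₂
      have hf0 : 0 ≤ m L / L := hε.le.trans hf1
      have hf0' : 0 ≤ 1 - m L / L := hε.le.trans hf2
      gcongr
    have hc₂0 : 0 ≤ c₂ := le_trans (by positivity) hc₂ε
    refine ⟨fun i j => ?_, κ, _, _, c₂, ?_, H, ?_⟩
    · rw [abs_le]
      rcases fstInd_eq_zero_or_one (t L) i with h | h <;>
        rcases fstInd_eq_zero_or_one (t L) j with h' | h' <;> simp only [h, h'] <;>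
          constructor <;> linarith
    · rw [abs_le]; constructor <;> nlinarith
    · have hd : ∫ ω, inDegSq (window (n L) L) k (fun i => Y i ω) ∂μ ≤ C ^ 2 * L := by
        refine (le_abs_self _).trans (abs_integral_le_of_bound ?_)
        filter_upwards [hwin L] with ω hω
        have := inDegSq_le hω
        rw [card_window (hn L)] at this
        rwa [abs_of_nonneg (Finset.sum_nonneg fun i _ => sq_nonneg _)]
      refine le_trans ?_ (le_weighted_variance (D := 3 * k ^ 2 + C ^ 2) hc₂0 hk1
        (integral_nonneg fun ω => Finset.sum_nonneg fun i _ => Finset.sum_nonneg fun j _ =>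
          mul_nonneg (knnInd_nonneg _ _ _ _ _) (knnInd_nonneg _ _ _ _ _)) (by positivity)
        (by linarith) hL1)
      gcongr
  · rintro ⟨δ, hδ, hq⟩
    simp_rw [edgeDiff_eq_graphForm]
    refine ae_tendsto_condStandardized_sub_standardized (Φ := fun L i j =>
      2 * (fstInd (t L) i * fstInd (t L) j - (1 - fstInd (t L) i) * (1 - fstInd (t L) j)))
      hdist hY hlaw hnt hk hC hwin hn hP (b := 2)
      -- This is `v δ` with `v = 4 (m/L) (1 - m/L) ≥ 4 ε²`.
      (c := 4 * ε * ε * δ) two_pos (by positivity) ?_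
    filter_upwards [hεm, hq, eventually_gt_atTop 1, eventually_gt_atTop k] with L hL hq hL1 hkL
    have hN1 : (1 : ℝ) < L := by exact_mod_cast hL1
    have hN0 : (0 : ℝ) < L := by linarith
    obtain ⟨hf1, hf2⟩ := hfrac L hN0 hL
    refine ⟨fun i j => ?_, 2 * (2 * (m L / L) - 1), _, _, _, ?_,
      pairMoments_diff (x := fun i : window (n L) L => fstInd (t L) i)
      (fun i => fstInd_eq_zero_or_one _ _) (hmL L hL1.le) (hcard L) hN0.ne' rfl rfl, ?_⟩
    · rw [abs_le]
      rcases fstInd_eq_zero_or_one (t L) i with h | h <;>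
        rcases fstInd_eq_zero_or_one (t L) j with h' | h' <;> simp only [h, h'] <;>
          constructor <;> linarith
    · rw [abs_le]; constructor <;> linarith
    -- The expected squared in-degrees are `L (q_{k,L} + k)`, so the threshold `k² - k` for
    -- `q_{k,L}` becomes `k²` per vertex.
    · have hd : (k ^ 2 + δ) * L ≤ ∫ ω, inDegSq (window (n L) L) k (fun i => Y i ω) ∂μ := by
        have e : ∀ᵐ ω ∂μ, ∑ i ∈ window (n L) L, ∑ j ∈ window (n L) L,
            ∑ l ∈ (window (n L) L).erase j, knnInd (window (n L) L) (fun m => Y m ω) k j i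
              * knnInd (window (n L) L) (fun m => Y m ω) k l i
            = inDegSq (window (n L) L) k (fun i => Y i ω) - k * L := by
          filter_upwards [hnt] with ω hω
          rw [inDegSq_eq hω (by rw [card_window (hn L)]; exact hkL), card_window (hn L)]
          ring
        have hI : Integrable (fun ω => inDegSq (window (n L) L) k fun i => Y i ω) μ :=
          integrable_of_measurable_of_bound ((measurable_inDegSq hdist _ k).comp hY)
            fun ω => abs_inDegSq_le _ _ _
        rw [sharedNN, integral_congr_ae e, integral_sub hI (integrable_const _), integral_const, one_div,
          le_inv_mul_iff₀ hN0] at hq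
        simp only [probReal_univ, one_smul] at hq
        linarith
      refine le_trans ?_ (le_diff_variance (δ := δ) ?_ hN1 rfl hδ.le hd)
      · have : 0 ≤ m L / L := by linarith
        gcongr
      · have : 0 ≤ 1 - m L / L := by linarith
        have : 0 ≤ m L / L := by linarith
        positivity
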